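/- **Setting.** noDice is a first-order, loop-free functional language in A-normal form. Types are $\tau ::= \mathtt{Bool}\mid\tau\times\tau$ and values are $v ::= \mathtt T\mid\mathtt F\mid(v,v)$. Atomic expressions $a$ are variables or values. Expressions are $a$, $(a,a)$, $\mathtt{fst}\,a$, $\mathtt{snd}\,a$, $\mathtt{if}\ a\ \mathtt{then}\ e\ \mathtt{else}\ e$, $\mathtt{let}\ x=e\ \mathtt{in}\ e$, $\mathit{func}(a)$, $\mathtt{flip}\,\theta$ with $\theta\in[0,1]\cap\mathbb Q$, $\mathtt{nflip}()$ and $\mathtt{observe}\,a$. A program $p$ is a sequence of (non-recursive) function definitions $\mathtt{fun}\ \mathit{func}(x{:}\tau){:}\tau'\,\{e\}$ followed by a main expression. **Semantics.** With respect to a function table, $[\![e]\!]$ is a set of sub-distributions over values: $[\![v]\!]=\{1|v\rangle\}$, and likewise for pairs of values and projections of pair values; $[\![\mathtt{flip}\,\theta]\!]=\{\theta|\mathtt T\rangle+(1-\theta)|\mathtt F\rangle\}$; $[\![\mathtt{nflip}()]\!]=\{\theta|\mathtt T\rangle+(1-\theta)|\mathtt F\rangle : \theta\in[0,1]\}$;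 $[\![\mathtt{observe}\,\mathtt T]\!]=\{1|\mathtt T\rangle\}$ and $[\![\mathtt{observe}\,\mathtt F]\!]=\{0\}$; an if-expression has the semantics of the selected branch; $d\in[\![\mathtt{let}\ x=e_1\ \mathtt{in}\ e_2]\!]$ iff there are $d_1\in[\![e_1]\!]$ and, for every $v$ with $d_1(v)>0$, some $d_v\in[\![e_2[x\mapsto v]]\!]$ with $d(v')=\sum_{v:\,d_1(v)>0}d_1(v)\,d_v(v')$ for all $v'$; $[\![\mathit{func}(v)]\!]$ is the semantics of the body of $\mathit{func}$ with its argument replaced by $v$; ill-formed expressions have the empty semantics. $[\![p]\!]$ is the semantics of the main expression in the function table built from the definitions, starting from the empty table. The normalized semantics is $[\![p]\!]_D=\{d/\sum_w d(w) : d\in[\![p]\!]\}$, with $0/0=0$. **Compilation.** The judgment $\Gamma,\Phi\vdash e:\tau\leadsto(\dot\varphi,\gamma,t)$, with a type environment $\Gamma$ and a compiled function table $\Phi$, produces a nested tuple $\dot\varphi$ of Boolean formulas of shape $\tau$ (the output), a Boolean formula $\gamma$ (all observations succeed) and a list $t=[f_1{:}a_1,\dots,f_k{:}a_k]$ of pairwise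 distinct flip variables, annotated with a probability $\theta$ or with $n$ (nondeterministic), by the following rules. A value compiles to $(v,\mathtt T,[\,])$ and a variable $x$ of type $\tau$ to $(F_\tau(x),\mathtt T,[\,])$, where $F_\tau(x)$ is the tuple of Boolean component variables of $x$; pairs and projections are compiled componentwise; $\mathtt{flip}\,\theta$ and $\mathtt{nflip}()$ compile to $(f,\mathtt T,[f{:}\theta])$ and $(f,\mathtt T,[f{:}n])$ with $f$ fresh; $\mathtt{observe}\,a$ compiles to $(\mathtt T,\varphi_a,[\,])$; $\mathtt{if}\ a\ \mathtt{then}\ e_T\ \mathtt{else}\ e_F$ compiles to $((\varphi_a\wedge\dot\varphi_T)\vee(\overline{\varphi_a}\wedge\dot\varphi_F),\ (\varphi_a\wedge\gamma_T)\vee(\overline{\varphi_a}\wedge\gamma_F),\ t_T\,@\,t_F)$, with componentwise connectives; $\mathtt{let}\ x=e_1\ \mathtt{in}\ e_2$ compiles to $(\dot\varphi_2[x\mapsto\dot\varphi_1],\ \gamma_1\wedge\gamma_2[x\mapsto\dot\varphi_1],\ t_1\,@\,t_2)$, where the components of $x$ are replaced simultaneously; a call of a function inserts the compiled body of the function with freshly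 renamed flip variables and with the argument substituted. A program compiles to the result for its main expression, after its function definitions have been compiled in order and added to $\Gamma$ and $\Phi$. **ADD and MDP.** Define $(\dot\varphi\mid\gamma)_t:\mathtt{Bool}^k\to[\![\tau]\!]\cup\{R\}$ by sending $b$ to the value of $\dot\varphi$ under $f_i\mapsto b_i$ if $\gamma$ is true under this assignment, and to $R$ otherwise. The reduced ADD for $(\dot\varphi,\gamma,t)$ is the ordered algebraic decision diagram with variable order $f_1<\dots<f_k$ (a finite rooted directed acyclic graph, all of whose nodes are reachable from the root) that represents this function and has no redundant tests, no duplicate tests and no duplicate outputs. The unnormalized MDP lifted from an ADD has the nodes as states, the root as initial state and the actions $l,r,d$. A terminal node loops under $d$; an inner node with a variable $f{:}\theta$ moves under $d$ to its then-successor with probability $\theta$ and to its else-successor with probability $1-\theta$; an inner node with a variable $f{:}n$ moves to its then-successor under $l$ and to its else-successor under $r$. A terminal node with value $v\neq R$ is labeled $\{v,A\}$, a terminal node with value $R$ is labeled $\{R\}$, and inner nodes are unlabeled. Schedulers $\Theta$ are memoryless and randomized: they assign to each state a probability distribution over its enabled actions. $Pr^{\Theta}(\lozenge F\mid\lozenge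 G)=Pr^\Theta(\lozenge F\wedge\lozenge G)/Pr^\Theta(\lozenge G)$, which is $0$ if $Pr^\Theta(\lozenge G)=0$, and $Pr^{\max}$ is the maximum over all $\Theta$. **Theorem (Inference Soundness).** Let $p$ be a noDice program with $\{\},\{\}\vdash p:\tau\leadsto(\dot\varphi,\gamma,t)$. Then a reduced ADD for $(\dot\varphi,\gamma,t)$ exists, and for every such reduced ADD, with $\mathcal M_p$ the unnormalized MDP lifted from it, and for every value $v$, both of the following maxima are attained and $$Pr^{\max}_{\mathcal M_p}(\lozenge v\mid\lozenge A)=\max\{d(v) : d\in[\![p]\!]_D\}.$$ -/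

import Mathlib

open scoped ENNReal BigOperators

noncomputable section

namespace NoDice

/-! ### Syntax (A-normal form) -/

/-- Identifiers of program variables. -/
abbrev Var := ℕ

/-- Identifiers of functions. -/
abbrev Fn := ℕ

/-- Types `τ ::= Bool | τ × τ`. -/
inductive Ty where
  | bool : Ty
  | prod : Ty → Ty → Ty
  deriving DecidableEq

/-- Values `v ::= T | F | (v, v)`. -/
inductive Value where
  | tt : Value
  | ff : Value
  | pair : Value → Value → Value
  deriving DecidableEq

/-- `HasType v τ`: the value `v` belongs to `⟦τ⟧`. -/
inductive HasType : Value → Ty → Prop where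
  | tt : HasType .tt .bool
  | ff : HasType .ff .bool
  | pair {v w : Value} {τ τ' : Ty} :
      HasType v τ → HasType w τ' → HasType (.pair v w) (.prod τ τ')

/-- Atomic expressions: variables and values. -/
inductive AExp where
  | var : Var → AExp
  | val : Value → AExp

/-- Expressions.  The parameter of `flip` is a rational number in `[0,1]`. -/
inductive Expr where
  | atom : AExp → Expr
  | tup : AExp → AExp → Expr
  | fst : AExp → Expr
  | snd : AExp → Expr
  | ite : AExp → Expr → Expr → Expr
  | letIn : Var → Expr → Expr → Expr
  | call : Fn → AExp → Expr
  | flip : Set.Icc (0 : ℚ) 1 → Expr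
  | nflip : Expr
  | observe : AExp → Expr

/-- A function definition `fun name (arg : argTy) : resTy { body }`. -/
structure FunDef where
  name : Fn
  arg : Var
  argTy : Ty
  resTy : Ty
  body : Expr

/-- A program: a sequence of function definitions followed by a main expression. -/
inductive Program where
  | main : Expr → Program
  | func : FunDef → Program → Program

/-- `a[x ↦ v]` -/
def AExp.subst (x : Var) (v : Value) : AExp → AExp
  | .var y => if y = x then .val v else .var y
  | .val w => .val w

/-- `e[x ↦ v]`: all free occurrences of `x` are replaced by the value `v`. -/
def Expr.subst (x : Var) (v : Value) : Expr → Expr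
  | .atom a => .atom (a.subst x v)
  | .tup a b => .tup (a.subst x v) (b.subst x v)
  | .fst a => .fst (a.subst x v)
  | .snd a => .snd (a.subst x v)
  | .ite a e₁ e₂ => .ite (a.subst x v) (e₁.subst x v) (e₂.subst x v)
  | .letIn y e₁ e₂ => .letIn y (e₁.subst x v) (if y = x then e₂ else e₂.subst x v)
  | .call g a => .call g (a.subst x v)
  | .flip θ => .flip θ
  | .nflip => .nflip
  | .observe a => .observe (a.subst x v)

/-- Number of constructors of an expression (used only as a termination measure). -/
def Expr.size : Expr → ℕ
  | .ite _ e₁ e₂ => e₁.size + e₂.size + 1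
  | .letIn _ e₁ e₂ => e₁.size + e₂.size + 1
  | _ => 1

theorem Expr.size_subst (x : Var) (v : Value) (e : Expr) : (e.subst x v).size = e.size := by
  induction e with
  | ite a e₁ e₂ h₁ h₂ => simp [Expr.subst, Expr.size, h₁, h₂]
  | letIn y e₁ e₂ h₁ h₂ =>
    simp only [Expr.subst, Expr.size, h₁]
    split_ifs <;> simp [h₂]
  | _ => rfl

/-! ### Semantics: sets of sub-distributions over values -/

/-- (Finitely supported) sub-distributions over values. -/
structure SubDist where
  mass : Value →₀ ℝ
  nonneg : ∀ v, 0 ≤ mass v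
  sum_le_one : ∑ v ∈ mass.support, mass v ≤ 1

instance : CoeFun SubDist (fun _ => Value → ℝ) := ⟨fun d => d.mass⟩

/-- The normalizing constant `d_D = ∑ v, d v`. -/
def SubDist.total (d : SubDist) : ℝ := ∑ v ∈ d.mass.support, d v

/-- The singleton set `{1|v⟩}`. -/
def dirac (v : Value) : Set SubDist := {d | ∀ w, d w = if w = v then 1 else 0}

/-- The singleton set `{θ|T⟩ + (1 - θ)|F⟩}`. -/
def coin (θ : ℝ) : Set SubDist :=
  {d | ∀ w, d w = if w = .tt then θ else if w = .ff then 1 - θ else 0}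

/-- Function tables (partial maps from function identifiers to their semantics). -/
abbrev FunTable := Fn → Option (Value → Set SubDist)

/-- The unnormalized semantics `⟦e⟧ᵀ` of (closed) expressions; ill-formed expressions have the
empty semantics. -/
def sem (T : FunTable) : Expr → Set SubDist
  | .atom a =>
      match a with
      | .val v => dirac v
      | _ => ∅
  | .tup a b =>
      match a, b with
      | .val v, .val w => dirac (.pair v w)
      | _, _ => ∅
  | .fst a =>
      match a with
      | .val (.pair v _) => dirac v
      | _ => ∅
  | .snd a =>
      match a with
      | .val (.pair _ w) => dirac w
      | _ => ∅
  | .ite a e₁ e₂ =>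
      match a with
      | .val .tt => sem T e₁
      | .val .ff => sem T e₂
      | _ => ∅
  | .letIn x e₁ e₂ =>
      {d | ∃ d₁ ∈ sem T e₁, ∃ D : Value → SubDist,
        (∀ v, 0 < d₁ v → D v ∈ sem T (e₂.subst x v)) ∧
        ∀ v', d v' = ∑ v ∈ d₁.mass.support, d₁ v * D v v'}
  | .call g a =>
      match T g, a with
      | some F, .val v => F v
      | _, _ => ∅
  | .flip θ => coin ((θ : ℚ) : ℝ)
  | .nflip => {d | ∃ θ ∈ Set.Icc (0 : ℝ) 1, d ∈ coin θ}
  | .observe a =>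
      match a with
      | .val .tt => dirac .tt
      | .val .ff => {d | ∀ w, d w = 0}
      | _ => ∅
termination_by e => e.size
decreasing_by
  all_goals (simp only [Expr.size, Expr.size_subst]; omega)

/-- The unnormalized semantics `⟦p⟧ᵀ` of programs. -/
def semProg : FunTable → Program → Set SubDist
  | T, .main e => sem T e
  | T, .func fd p =>
      semProg (Function.update T fd.name (some fun v => sem T (fd.body.subst fd.arg v))) p

/-- Normalization of a set of sub-distributions (`x / 0 = 0`). -/
def normalize (S : Set SubDist) : Set SubDist :=
  {d' | ∃ d ∈ S, ∀ v, d' v = d v / d.total}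

/-- The normalized semantics `⟦p⟧_D` of a program, starting with the empty function table. -/
def normSem (p : Program) : Set SubDist := normalize (semProg (fun _ => none) p)

/-! ### Boolean formulas and tuples of Boolean formulas -/

/-- Left and right component of a pair. -/
inductive Side where
  | l : Side
  | r : Side
  deriving DecidableEq

/-- Variables of Boolean formulas: `comp x p` is the Boolean component at position `p` of the
program variable `x` (so `comp x [l]` is `x_l`), and `flip f` is a flip variable. -/
inductive FVar where
  | comp : Var → List Side → FVar
  | flip : ℕ → FVar

/-- Boolean formulas. -/
inductive BForm where
  | tt : BForm
  | ff : BForm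
  | var : FVar → BForm
  | not : BForm → BForm
  | and : BForm → BForm → BForm
  | or : BForm → BForm → BForm

/-- Nested tuples of Boolean formulas. -/
inductive MForm where
  | leaf : BForm → MForm
  | pair : MForm → MForm → MForm

/-- A value, seen as a tuple of formulas. -/
def MForm.ofValue : Value → MForm
  | .tt => .leaf .tt
  | .ff => .leaf .ff
  | .pair v w => .pair (ofValue v) (ofValue w)

/-- The form function: `formF τ x p` is the template `F_τ` for the component at position `p` of
the program variable `x`. -/
def formF : Ty → Var → List Side → MForm
  | .bool, x, p => .leaf (.var (.comp x p))
  | .prod τ τ', x, p => .pair (formF τ x (p ++ [.l])) (formF τ' x (p ++ [.r]))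

/-- Broadcast conjunction. -/
def MForm.bAnd (g : BForm) : MForm → MForm
  | .leaf φ => .leaf (.and g φ)
  | .pair φ ψ => .pair (bAnd g φ) (bAnd g ψ)

/-- Pointwise disjunction of two tuples of the same shape (on different shapes, which never
meet in a compilation, the value is irrelevant). -/
def MForm.pOr : MForm → MForm → MForm
  | .leaf φ, .leaf ψ => .leaf (.or φ ψ)
  | .pair φ φ', .pair ψ ψ' => .pair (pOr φ ψ) (pOr φ' ψ')
  | φ, _ => φ

/-- The Boolean formula at a position of a tuple, if there is one. -/
def MForm.at? : MForm → List Side → Option BForm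
  | .leaf φ, [] => some φ
  | .pair φ _, .l :: p => φ.at? p
  | .pair _ ψ, .r :: p => ψ.at? p
  | _, _ => none

/-- `φ[x ↦ χ]` for a tuple `χ`: every Boolean component of `x` is replaced by the formula at the
same position of `χ`.  All components are replaced simultaneously; this is the same as replacing
`x_l` and then `x_r` whenever `x` does not itself occur in `χ`. -/
def BForm.subst : BForm → Var → MForm → BForm
  | .tt, _, _ => .tt
  | .ff, _, _ => .ff
  | .var (.comp y p), x, χ =>
      if y = x then (χ.at? p).getD (.var (.comp y p)) else .var (.comp y p)
  | .var (.flip f), _, _ => .var (.flip f)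
  | .not φ, x, χ => .not (φ.subst x χ)
  | .and φ ψ, x, χ => .and (φ.subst x χ) (ψ.subst x χ)
  | .or φ ψ, x, χ => .or (φ.subst x χ) (ψ.subst x χ)

/-- Substitution in a tuple. -/
def MForm.subst : MForm → Var → MForm → MForm
  | .leaf φ, x, χ => .leaf (φ.subst x χ)
  | .pair φ ψ, x, χ => .pair (φ.subst x χ) (ψ.subst x χ)

/-- Renaming of flip variables. -/
def BForm.rename (ρ : ℕ → ℕ) : BForm → BForm
  | .tt => .tt
  | .ff => .ff
  | .var (.comp y p) => .var (.comp y p)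
  | .var (.flip f) => .var (.flip (ρ f))
  | .not φ => .not (φ.rename ρ)
  | .and φ ψ => .and (φ.rename ρ) (ψ.rename ρ)
  | .or φ ψ => .or (φ.rename ρ) (ψ.rename ρ)

/-- Renaming of flip variables in a tuple. -/
def MForm.rename (ρ : ℕ → ℕ) : MForm → MForm
  | .leaf φ => .leaf (φ.rename ρ)
  | .pair φ ψ => .pair (φ.rename ρ) (ψ.rename ρ)

/-! ### Compilation -/

/-- Behaviour of a flip: probabilistic with parameter `θ`, or nondeterministic. -/
inductive FlipKind where
  | prob : Set.Icc (0 : ℚ) 1 → FlipKind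
  | nondet : FlipKind

/-- Annotated traces of flips `[f₁ : a₁, …, f_k : a_k]`. -/
abbrev Trace := List (ℕ × FlipKind)

/-- The flip variables of a trace. -/
def Trace.flips (t : Trace) : List ℕ := t.map Prod.fst

/-- Renaming of the flip variables of a trace. -/
def Trace.rename (ρ : ℕ → ℕ) (t : Trace) : Trace := t.map fun q => (ρ q.1, q.2)

/-- Type environments: types of variables and of functions. -/
structure TyEnv where
  var : Var → Option Ty
  fn : Fn → Option (Ty × Ty)

/-- The empty environment. -/
def TyEnv.empty : TyEnv := ⟨fun _ => none, fun _ => none⟩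

/-- `Γ ∪ {x ↦ τ}` -/
def TyEnv.addVar (Γ : TyEnv) (x : Var) (τ : Ty) : TyEnv :=
  { Γ with var := Function.update Γ.var x (some τ) }

/-- `Γ ∪ {g ↦ (τ → τ')}` -/
def TyEnv.addFn (Γ : TyEnv) (g : Fn) (τ τ' : Ty) : TyEnv :=
  { Γ with fn := Function.update Γ.fn g (some (τ, τ')) }

/-- An entry `(x_arg, φ, γ, t)` of a compiled function table. -/
structure CompFn where
  arg : Var
  model : MForm
  acc : BForm
  trace : Trace

/-- Compiled function tables. -/
abbrev CompTable := Fn → Option CompFn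

/-- Compilation of atomic expressions, `Γ ⊢ a : τ ⇝ (φ, T, [])`. -/
inductive CompA (Γ : TyEnv) : AExp → Ty → MForm → Prop where
  | val {v : Value} {τ : Ty} : HasType v τ → CompA Γ (.val v) τ (.ofValue v)
  | ident {x : Var} {τ : Ty} : Γ.var x = some τ → CompA Γ (.var x) τ (formF τ x [])

/-- Compilation of expressions, `Γ, Φ ⊢ e : τ ⇝ (φ, γ, t)`.  Freshness of flip variables means
that the traces of different sub-expressions, and of different calls, have no flip variable in
common; at a call, the flips of the function are renamed injectively. -/
inductive Comp (Φ : CompTable) : TyEnv → Expr → Ty → MForm → BForm → Trace → Prop where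
  | atom {Γ : TyEnv} {a : AExp} {τ : Ty} {φ : MForm} :
      CompA Γ a τ φ → Comp Φ Γ (.atom a) τ φ .tt []
  | flip {Γ : TyEnv} (f : ℕ) (θ : Set.Icc (0 : ℚ) 1) :
      Comp Φ Γ (.flip θ) .bool (.leaf (.var (.flip f))) .tt [(f, .prob θ)]
  | nflip {Γ : TyEnv} (f : ℕ) :
      Comp Φ Γ .nflip .bool (.leaf (.var (.flip f))) .tt [(f, .nondet)]
  | tup {Γ : TyEnv} {a b : AExp} {τ τ' : Ty} {φ ψ : MForm} :
      CompA Γ a τ φ → CompA Γ b τ' ψ →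
      Comp Φ Γ (.tup a b) (.prod τ τ') (.pair φ ψ) .tt []
  | observe {Γ : TyEnv} {a : AExp} {φ : BForm} :
      CompA Γ a .bool (.leaf φ) → Comp Φ Γ (.observe a) .bool (.leaf .tt) φ []
  | fst {Γ : TyEnv} {a : AExp} {τ τ' : Ty} {φ ψ : MForm} :
      CompA Γ a (.prod τ τ') (.pair φ ψ) → Comp Φ Γ (.fst a) τ φ .tt []
  | snd {Γ : TyEnv} {a : AExp} {τ τ' : Ty} {φ ψ : MForm} :
      CompA Γ a (.prod τ τ') (.pair φ ψ) → Comp Φ Γ (.snd a) τ' ψ .tt []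
  | ite {Γ : TyEnv} {a : AExp} {e₁ e₂ : Expr} {τ : Ty} {g : BForm} {φ₁ φ₂ : MForm}
      {γ₁ γ₂ : BForm} {t₁ t₂ : Trace} :
      CompA Γ a .bool (.leaf g) →
      Comp Φ Γ e₁ τ φ₁ γ₁ t₁ → Comp Φ Γ e₂ τ φ₂ γ₂ t₂ →
      List.Disjoint t₁.flips t₂.flips →
      Comp Φ Γ (.ite a e₁ e₂) τ (.pOr (.bAnd g φ₁) (.bAnd (.not g) φ₂))
        (.or (.and g γ₁) (.and (.not g) γ₂)) (t₁ ++ t₂)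
  | letIn {Γ : TyEnv} {x : Var} {e₁ e₂ : Expr} {τ₁ τ₂ : Ty} {φ₁ φ₂ : MForm}
      {γ₁ γ₂ : BForm} {t₁ t₂ : Trace} :
      Comp Φ Γ e₁ τ₁ φ₁ γ₁ t₁ → Comp Φ (Γ.addVar x τ₁) e₂ τ₂ φ₂ γ₂ t₂ →
      List.Disjoint t₁.flips t₂.flips →
      Comp Φ Γ (.letIn x e₁ e₂) τ₂ (φ₂.subst x φ₁) (.and γ₁ (γ₂.subst x φ₁)) (t₁ ++ t₂)
  | call {Γ : TyEnv} {g : Fn} {a : AExp} {τ₁ τ₂ : Ty} {χ : MForm} {c : CompFn} (ρ : ℕ → ℕ) :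
      CompA Γ a τ₁ χ → Γ.fn g = some (τ₁, τ₂) → Φ g = some c →
      Set.InjOn ρ {f | f ∈ c.trace.flips} →
      Comp Φ Γ (.call g a) τ₂ ((c.model.rename ρ).subst c.arg χ)
        ((c.acc.rename ρ).subst c.arg χ) (c.trace.rename ρ)

/-- Compilation of function definitions. -/
def CompFun (Γ : TyEnv) (Φ : CompTable) (fd : FunDef) (φ : MForm) (γ : BForm) (t : Trace) :
    Prop :=
  Comp Φ (Γ.addVar fd.arg fd.argTy) fd.body fd.resTy φ γ t

/-- Compilation of programs, `Γ, Φ ⊢ p : τ ⇝ (φ, γ, t)`. -/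
inductive CompProg : TyEnv → CompTable → Program → Ty → MForm → BForm → Trace → Prop where
  | main {Γ : TyEnv} {Φ : CompTable} {e : Expr} {τ : Ty} {φ : MForm} {γ : BForm} {t : Trace} :
      Comp Φ Γ e τ φ γ t → CompProg Γ Φ (.main e) τ φ γ t
  | func {Γ : TyEnv} {Φ : CompTable} {fd : FunDef} {p : Program} {τ : Ty} {φ φ' : MForm}
      {γ γ' : BForm} {t t' : Trace} :
      CompFun Γ Φ fd φ' γ' t' →
      CompProg (Γ.addFn fd.name fd.argTy fd.resTy)
        (Function.update Φ fd.name (some ⟨fd.arg, φ', γ', t'⟩)) p τ φ γ t →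
      CompProg Γ Φ (.func fd p) τ φ γ t

/-- `p` compiles to `(φ, γ, t)` with type `τ`, starting from empty contexts. -/
def Compiles (p : Program) (τ : Ty) (φ : MForm) (γ : BForm) (t : Trace) : Prop :=
  CompProg TyEnv.empty (fun _ => none) p τ φ γ t

/-! ### The guarded function `(φ | γ)_t` -/

/-- Truth value of a formula under an assignment. -/
def BForm.eval (ω : FVar → Bool) : BForm → Bool
  | .tt => true
  | .ff => false
  | .var z => ω z
  | .not φ => !(φ.eval ω)
  | .and φ ψ => φ.eval ω && ψ.eval ω
  | .or φ ψ => φ.eval ω || ψ.eval ω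

/-- Value of a tuple of formulas under an assignment. -/
def MForm.eval (ω : FVar → Bool) : MForm → Value
  | .leaf φ => if φ.eval ω then .tt else .ff
  | .pair φ ψ => .pair (φ.eval ω) (ψ.eval ω)

/-- The assignment giving the `i`-th flip variable of `t` the value `b i`.  (Other variables do
not occur in the formulas of a closed program.) -/
def assignment (t : Trace) (b : Fin t.length → Bool) : FVar → Bool
  | .flip f => decide (∃ i : Fin t.length, (t.get i).1 = f ∧ b i = true)
  | .comp _ _ => false

/-- Outcomes: a value, or the special value `R` of a rejected run. -/
inductive Outcome where
  | val : Value → Outcome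
  | rejected : Outcome

/-- The function `(φ | γ)_t : Boolᵏ → ⟦τ⟧ ∪ {R}`. -/
def guarded (φ : MForm) (γ : BForm) (t : Trace) (b : Fin t.length → Bool) : Outcome :=
  if γ.eval (assignment t b) then .val (φ.eval (assignment t b)) else .rejected

/-! ### Algebraic decision diagrams -/

/-- Algebraic decision diagrams over `k` Boolean variables with outputs in `S`: rooted finite
directed acyclic graphs with inner nodes `V` and terminal nodes `T`. -/
structure ADD (k : ℕ) (S : Type) where
  V : Type
  T : Type
  [fintypeV : Fintype V]
  [fintypeT : Fintype T]
  root : V ⊕ T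
  var : V → Fin k
  thenN : V → V ⊕ T
  elseN : V → V ⊕ T
  val : T → S
  acyclic : ∀ u : V ⊕ T,
    ¬ Relation.TransGen (fun x y => ∃ w, x = Sum.inl w ∧ (y = thenN w ∨ y = elseN w)) u u
  rooted : ∀ u : V ⊕ T,
    Relation.ReflTransGen (fun x y => ∃ w, x = Sum.inl w ∧ (y = thenN w ∨ y = elseN w)) root u

attribute [instance] ADD.fintypeV ADD.fintypeT

/-- `A.Evals b u s`: under the input `b`, the function of the node `u` has the value `s`. -/
inductive ADD.Evals {k : ℕ} {S : Type} (A : ADD k S) (b : Fin k → Bool) : A.V ⊕ A.T → S → Prop where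
  | terminal (u : A.T) : Evals A b (.inr u) (A.val u)
  | thenN (u : A.V) {s : S} : b (A.var u) = true → Evals A b (A.thenN u) s → Evals A b (.inl u) s
  | elseN (u : A.V) {s : S} : b (A.var u) = false → Evals A b (A.elseN u) s → Evals A b (.inl u) s

/-- The diagram encodes the function `f`. -/
def ADD.Represents {k : ℕ} {S : Type} (A : ADD k S) (f : (Fin k → Bool) → S) : Prop :=
  ∀ b, A.Evals b A.root (f b)

/-- Along every path the variables occur in the order `0, 1, …, k - 1`. -/
def ADD.Ordered {k : ℕ} {S : Type} (A : ADD k S) : Prop :=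
  ∀ u w : A.V, A.thenN u = .inl w ∨ A.elseN u = .inl w → A.var u < A.var w

/-- No redundant tests, no duplicate tests and no duplicate outputs. -/
structure ADD.Reduced {k : ℕ} {S : Type} (A : ADD k S) : Prop where
  no_redundant : ∀ u, A.thenN u ≠ A.elseN u
  no_dup_test : ∀ u w, u ≠ w →
    A.var u ≠ A.var w ∨ A.thenN u ≠ A.thenN w ∨ A.elseN u ≠ A.elseN w
  no_dup_out : ∀ u w, u ≠ w → A.val u ≠ A.val w

/-- `A` is an ADD for `(φ, γ, t)`: the `i`-th variable of `A` stands for the `i`-th flip of `t`,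
`A` uses the variable order of `t`, and `A` represents `(φ | γ)_t`. -/
def IsADDFor (φ : MForm) (γ : BForm) (t : Trace) (A : ADD t.length Outcome) : Prop :=
  A.Ordered ∧ A.Represents (guarded φ γ t)

/-- `A` is the reduced ADD for `(φ, γ, t)`. -/
def IsReducedADDFor (φ : MForm) (γ : BForm) (t : Trace) (A : ADD t.length Outcome) : Prop :=
  IsADDFor φ γ t A ∧ A.Reduced

/-! ### Markov decision processes and conditional reachability -/

/-- Finite Markov decision processes. -/
structure MDP where
  S : Type
  [fintypeS : Fintype S]
  start : S
  Act : Type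
  [fintypeAct : Fintype Act]
  P : S → Act → S → ℝ
  AP : Type
  L : S → Set AP
  nonneg : ∀ s α s', 0 ≤ P s α s'
  sum_eq : ∀ s α, ∑ s', P s α s' = 0 ∨ ∑ s', P s α s' = 1

attribute [instance] MDP.fintypeS MDP.fintypeAct

/-- An action is enabled if it has a successor of positive probability. -/
def MDP.Enabled (M : MDP) (s : M.S) (α : M.Act) : Prop := ∃ s', 0 < M.P s α s'

/-- Memoryless schedulers: every state is given a distribution over its enabled actions. -/
structure MDP.Scheduler (M : MDP) where
  choice : M.S → M.Act → ℝ
  nonneg : ∀ s α, 0 ≤ choice s α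
  sum_one : ∀ s, ∑ α, choice s α = 1
  enabled : ∀ s α, choice s α ≠ 0 → M.Enabled s α

/-- The set of states in which the atomic proposition `a` holds. -/
def MDP.states (M : MDP) (a : M.AP) : Set M.S := {s | a ∈ M.L s}

/-- The probability of a finite path. -/
def MDP.pathProb (M : MDP) (Θ : M.Scheduler) : List M.S → ℝ
  | s :: s' :: π => (∑ α, Θ.choice s α * M.P s α s') * M.pathProb Θ (s' :: π)
  | _ => 1

/-- `◇F`: the finite paths from the initial state that end in their first visit to `F`. -/
def MDP.reach (M : MDP) (F : Set M.S) : Set (List M.S) :=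
  {π | π.head? = some M.start ∧ ∃ l s, π = l ++ [s] ∧ (∀ x ∈ l, x ∉ F) ∧ s ∈ F}

/-- `◇F ∧ ◇G`: the finite paths from the initial state that end as soon as both `F` and `G` have
been visited. -/
def MDP.reachBoth (M : MDP) (F G : Set M.S) : Set (List M.S) :=
  {π | π.head? = some M.start ∧ ∃ l s, π = l ++ [s] ∧
    ¬ ((∃ x ∈ l, x ∈ F) ∧ (∃ x ∈ l, x ∈ G)) ∧ (∃ x ∈ π, x ∈ F) ∧ (∃ x ∈ π, x ∈ G)}

/-- The total probability of a set of finite paths. -/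
def MDP.Pr (M : MDP) (Θ : M.Scheduler) (E : Set (List M.S)) : ℝ≥0∞ :=
  ∑' π : E, ENNReal.ofReal (M.pathProb Θ π)

/-- `Pr^Θ(◇F | ◇G)`, which is `0` if `Pr^Θ(◇G) = 0`. -/
def MDP.condReach (M : MDP) (Θ : M.Scheduler) (F G : Set M.S) : ℝ :=
  (M.Pr Θ (M.reachBoth F G) / M.Pr Θ (M.reach G)).toReal

/-- `m` is the maximal conditional reachability probability `Pr^max(◇F | ◇G)`. -/
def MDP.IsMaxCondReach (M : MDP) (F G : Set M.S) (m : ℝ) : Prop :=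
  IsGreatest {x | ∃ Θ : M.Scheduler, x = M.condReach Θ F G} m

/-! ### Lifting -/

/-- The actions of the lifted MDP. -/
inductive LAct where
  | l : LAct
  | r : LAct
  | d : LAct
  deriving DecidableEq

instance : Fintype LAct := ⟨{.l, .r, .d}, by intro x; cases x <;> simp⟩

/-- The atomic propositions of the lifted MDP: values, `A` (accepted) and `R` (rejected). -/
inductive LProp where
  | val : Value → LProp
  | accepted : LProp
  | rejected : LProp

open Classical in
/-- The Dirac weight at `s`. -/
def pt {S : Type} (s s' : S) : ℝ := if s' = s then 1 else 0

theorem pt_nonneg {S : Type} (s s' : S) : 0 ≤ pt s s' := by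
  unfold pt; split_ifs <;> norm_num

theorem sum_pt {S : Type} [Fintype S] (s : S) : ∑ s', pt s s' = 1 := by
  classical
  simp [pt]

/-- The transition function of the lifted MDP. -/
def liftP (t : Trace) (A : ADD t.length Outcome) : A.V ⊕ A.T → LAct → A.V ⊕ A.T → ℝ
  | .inr u, .d, s' => pt (.inr u) s'
  | .inr _, _, _ => 0
  | .inl u, α, s' =>
      match (t.get (A.var u)).2, α with
      | .prob θ, .d => ((θ : ℚ) : ℝ) * pt (A.thenN u) s' + (1 - ((θ : ℚ) : ℝ)) * pt (A.elseN u) s'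
      | .nondet, .l => pt (A.thenN u) s'
      | .nondet, .r => pt (A.elseN u) s'
      | _, _ => 0

/-- The labeling function of the lifted MDP. -/
def liftL (t : Trace) (A : ADD t.length Outcome) : A.V ⊕ A.T → Set LProp
  | .inr u =>
      match A.val u with
      | .val v => {.val v, .accepted}
      | .rejected => {.rejected}
  | .inl _ => ∅

theorem liftP_nonneg (t : Trace) (A : ADD t.length Outcome) (s : A.V ⊕ A.T) (α : LAct)
    (s' : A.V ⊕ A.T) : 0 ≤ liftP t A s α s' := by
  unfold liftP
  split
  · exact pt_nonneg _ _
  · exact le_rfl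
  · split
    · rename_i θ _
      have h0 : (0 : ℝ) ≤ ((θ : ℚ) : ℝ) := by exact_mod_cast θ.2.1
      have h1 : ((θ : ℚ) : ℝ) ≤ 1 := by exact_mod_cast θ.2.2
      exact add_nonneg (mul_nonneg h0 (pt_nonneg _ _))
        (mul_nonneg (sub_nonneg.2 h1) (pt_nonneg _ _))
    · exact pt_nonneg _ _
    · exact pt_nonneg _ _
    · exact le_rfl

theorem liftP_sum (t : Trace) (A : ADD t.length Outcome) (s : A.V ⊕ A.T) (α : LAct) :
    ∑ s', liftP t A s α s' = 0 ∨ ∑ s', liftP t A s α s' = 1 := by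
  rcases s with u | u
  · rcases h : (t.get (A.var u)).2 with θ | _ <;> cases α <;>
      simp only [liftP, h, Finset.sum_add_distrib, ← Finset.mul_sum, sum_pt] <;> simp
  · cases α <;> simp [liftP, sum_pt]

/-- The unnormalized MDP lifted from an ADD for `(φ, γ, t)`. -/
def lift (t : Trace) (A : ADD t.length Outcome) : MDP where
  S := A.V ⊕ A.T
  start := A.root
  Act := LAct
  P := liftP t A
  AP := LProp
  L := liftL t A
  nonneg := liftP_nonneg t A
  sum_eq := liftP_sum t A

end NoDice

end

/-! Both sides are maxima of a ratio N / D, where N is the mass of `v` and D the mass of all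
accepted values. Ratios do not compose along a program, but optimal expected rewards do. So every
reward `r` on values is considered, with rejected runs earning 0, and the greatest expected reward
is shown to be the same for the program and for the MDP. The reward "indicator of `v`, plus β" then
gives equal maxima of N + βD for every real β, and these determine the maximum of N / D.

The bridge is `opt`, backward induction along the trace of flips: average at a probabilistic flip,
take the larger value at a nondeterministic one. `isGreatest_rewards_sem` identifies it with the
greatest expected reward over the semantics, by induction on the compilation. A `let` is the dynamic
programming principle (`isGreatest_rewards_bindSet`, `opt_letIn`), the flips of an untaken branch
are idle (`opt_ite`), and a call is an injective renaming (`opt_call`). In `opt` a nondeterministic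
flip may react to all earlier flips, in the semantics a continuation sees only the bound value, and
a scheduler sees only the current node. The optimum is unaffected, since the best continuation
reward depends on that value, or that node, alone.

On the diagram, `opt_drop_eq_bestValue` matches the flips of the trace with the levels of the
diagram; a skipped level changes nothing. For a fixed scheduler the reachability probabilities
follow a recursion down the diagram (`Pr_reachFrom_lift`), so they are linear in the rewards of the
terminals. The greedy choice shows that one of the finitely many deterministic schedulers is optimal
for each reward.

Finiteness gives the maximal ratio on the MDP side. Attainment on the semantic side needs an
argument, because a maximizer of N - mD may have D = 0; `exists_isGreatest_ratio` perturbs β to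
exclude this. Existence of a reduced diagram is separate: its nodes are the distinct subfunctions
obtained by fixing leading variables (`reducedADD`). -/

namespace NoDice

/-! ### Optimal expected rewards of traces -/

/-- The assignment `ω` with the flip variable `f` set to `b`. -/
def setFlip (ω : FVar → Bool) (f : ℕ) (b : Bool) : FVar → Bool
  | .comp x p => ω (.comp x p)
  | .flip g => if g = f then b else ω (.flip g)

/-- The best expected reward of a flip whose outcomes have the rewards `x` and `y`. -/
noncomputable def FlipKind.combine : FlipKind → ℝ → ℝ → ℝ
  | .prob θ, x, y => ((θ : ℚ) : ℝ) * x + (1 - ((θ : ℚ) : ℝ)) * y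
  | .nondet, x, y => max x y

theorem FlipKind.combine_self (a : FlipKind) (x : ℝ) : a.combine x x = x := by
  cases a
  · simp only [combine]; ring
  · simp [combine]

/-- The best expected reward, starting from the assignment `ω`, if the flips of the trace are
performed in order and the final assignment is rewarded by `g`. -/
noncomputable def opt : Trace → ((FVar → Bool) → ℝ) → (FVar → Bool) → ℝ
  | [], g, ω => g ω
  | q :: t, g, ω => q.2.combine (opt t g (setFlip ω q.1 true)) (opt t g (setFlip ω q.1 false))

/-- Backward induction splits at any point: the optimal value of the later flips serves as the
reward of the earlier ones. This is how `@` in the compilation rules is analysed. -/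
theorem opt_append (t₁ t₂ : Trace) (g : (FVar → Bool) → ℝ) (ω : FVar → Bool) :
    opt (t₁ ++ t₂) g ω = opt t₁ (opt t₂ g) ω := by
  induction t₁ generalizing ω with
  | nil => rfl
  | cons q t ih => simp only [List.cons_append, opt, ih]

theorem opt_const (t : Trace) (c : ℝ) (ω : FVar → Bool) : opt t (fun _ => c) ω = c := by
  induction t generalizing ω with
  | nil => rfl
  | cons q t ih => simp only [opt, ih, FlipKind.combine_self]

/-- Two related assignments have the same optimal reward, if setting flips preserves the relation
and related assignments are rewarded equally. -/
theorem opt_rename_of_rel (ρ : ℕ → ℕ) (t : Trace) {g g' : (FVar → Bool) → ℝ}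
    (R : (FVar → Bool) → (FVar → Bool) → Prop)
    (hR : ∀ f ∈ t.flips, ∀ b ω ω', R ω ω' → R (setFlip ω (ρ f) b) (setFlip ω' f b))
    (hg : ∀ ω ω', R ω ω' → g ω = g' ω') {ω ω' : FVar → Bool} (h : R ω ω') :
    opt (t.rename ρ) g ω = opt t g' ω' := by
  induction t generalizing ω ω' with
  | nil => exact hg _ _ h
  | cons q t ih =>
    have hq : q.1 ∈ Trace.flips (q :: t) := by simp [Trace.flips]
    have ih' := @ih (fun f hf => hR f (by simp only [Trace.flips, List.map_cons] at hf ⊢; exact List.mem_cons_of_mem _ hf))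
    simp only [Trace.rename, List.map_cons, opt] at ih' ⊢
    rw [ih' (hR _ hq _ _ _ h), ih' (hR _ hq _ _ _ h)]

theorem Trace.rename_id (t : Trace) : t.rename id = t := by simp [Trace.rename]

theorem opt_eq_of_rel (t : Trace) {g g' : (FVar → Bool) → ℝ}
    (R : (FVar → Bool) → (FVar → Bool) → Prop)
    (hR : ∀ f ∈ t.flips, ∀ b ω ω', R ω ω' → R (setFlip ω f b) (setFlip ω' f b))
    (hg : ∀ ω ω', R ω ω' → g ω = g' ω') {ω ω' : FVar → Bool} (h : R ω ω') :
    opt t g ω = opt t g' ω' := by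
  have := opt_rename_of_rel id t R hR hg h
  rwa [Trace.rename_id] at this

/-- The assignments agree outside of the flip variables in `S`. -/
def AgreeOff (S : Set ℕ) (ω ω' : FVar → Bool) : Prop :=
  (∀ x p, ω' (.comp x p) = ω (.comp x p)) ∧ ∀ f, f ∉ S → ω' (.flip f) = ω (.flip f)

theorem AgreeOff.refl (S : Set ℕ) (ω : FVar → Bool) : AgreeOff S ω ω :=
  ⟨fun _ _ => rfl, fun _ _ => rfl⟩

theorem AgreeOff.setFlip {S : Set ℕ} {ω ω' : FVar → Bool} (h : AgreeOff S ω ω') {f : ℕ}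
    (hf : f ∈ S) (b : Bool) : AgreeOff S ω (setFlip ω' f b) := by
  refine ⟨h.1, fun g hg => ?_⟩
  have : g ≠ f := fun e => hg (e ▸ hf)
  simpa [NoDice.setFlip, this] using h.2 g hg

/-- Performing the flips of `t` only reaches assignments that differ from `ω` on those flips, so
rewards elsewhere are irrelevant. -/
theorem opt_congr {t : Trace} {g g' : (FVar → Bool) → ℝ} {ω : FVar → Bool}
    (h : ∀ ω', AgreeOff {f | f ∈ t.flips} ω ω' → g ω' = g' ω') : opt t g ω = opt t g' ω := by
  refine opt_eq_of_rel t (fun ω₁ ω₂ => ω₁ = ω₂ ∧ AgreeOff {f | f ∈ t.flips} ω ω₁) ?_ ?_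
    ⟨rfl, AgreeOff.refl _ _⟩
  · rintro f hf b ω₁ _ ⟨rfl, h₁⟩
    exact ⟨rfl, h₁.setFlip hf b⟩
  · rintro ω₁ _ ⟨rfl, h₁⟩
    exact h _ h₁

theorem opt_eq_const {t : Trace} {g : (FVar → Bool) → ℝ} {ω : FVar → Bool} {c : ℝ}
    (h : ∀ ω', AgreeOff {f | f ∈ t.flips} ω ω' → g ω' = c) : opt t g ω = c :=
  (opt_congr h).trans (opt_const t c ω)

/-! ### Flip variables, shapes and evaluation of formulas -/

/-- All flip variables of the formula are in `S`. -/
def BForm.FlipsIn (S : Set ℕ) : BForm → Prop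
  | .tt => True
  | .ff => True
  | .var (.comp _ _) => True
  | .var (.flip f) => f ∈ S
  | .not φ => φ.FlipsIn S
  | .and φ ψ => φ.FlipsIn S ∧ ψ.FlipsIn S
  | .or φ ψ => φ.FlipsIn S ∧ ψ.FlipsIn S

/-- All flip variables of the tuple are in `S`. -/
def MForm.FlipsIn (S : Set ℕ) : MForm → Prop
  | .leaf φ => φ.FlipsIn S
  | .pair φ ψ => φ.FlipsIn S ∧ ψ.FlipsIn S

theorem BForm.FlipsIn.mono {S S' : Set ℕ} (h : S ⊆ S') :
    ∀ {φ : BForm}, φ.FlipsIn S → φ.FlipsIn S'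
  | .tt, _ => trivial
  | .ff, _ => trivial
  | .var (.comp _ _), _ => trivial
  | .var (.flip _), hf => h hf
  | .not φ, hφ => mono (φ := φ) h hφ
  | .and _ _, hφ => ⟨mono h hφ.1, mono h hφ.2⟩
  | .or _ _, hφ => ⟨mono h hφ.1, mono h hφ.2⟩

theorem MForm.FlipsIn.mono {S S' : Set ℕ} (h : S ⊆ S') :
    ∀ {φ : MForm}, φ.FlipsIn S → φ.FlipsIn S'
  | .leaf _, hφ => BForm.FlipsIn.mono h hφ
  | .pair _ _, hφ => ⟨mono h hφ.1, mono h hφ.2⟩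

theorem BForm.eval_congr {S : Set ℕ} {ω ω' : FVar → Bool}
    (hc : ∀ x p, ω' (.comp x p) = ω (.comp x p)) (hf : ∀ f ∈ S, ω' (.flip f) = ω (.flip f)) :
    ∀ {φ : BForm}, φ.FlipsIn S → φ.eval ω' = φ.eval ω
  | .tt, _ => rfl
  | .ff, _ => rfl
  | .var (.comp _ _), _ => hc _ _
  | .var (.flip _), h => hf _ h
  | .not φ, h => by simp only [eval, eval_congr hc hf (φ := φ) h]
  | .and φ ψ, h => by simp only [eval, eval_congr hc hf h.1, eval_congr hc hf h.2]
  | .or φ ψ, h => by simp only [eval, eval_congr hc hf h.1, eval_congr hc hf h.2]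

theorem MForm.eval_congr {S : Set ℕ} {ω ω' : FVar → Bool}
    (hc : ∀ x p, ω' (.comp x p) = ω (.comp x p)) (hf : ∀ f ∈ S, ω' (.flip f) = ω (.flip f)) :
    ∀ {φ : MForm}, φ.FlipsIn S → φ.eval ω' = φ.eval ω
  | .leaf φ, h => by simp only [eval, BForm.eval_congr hc hf (φ := φ) h]
  | .pair φ ψ, h => by simp only [eval, eval_congr hc hf h.1, eval_congr hc hf h.2]

theorem BForm.eval_agreeOff {S S' : Set ℕ} {ω ω' : FVar → Bool} (h : AgreeOff S' ω ω')
    (hd : Disjoint S S') {φ : BForm} (hφ : φ.FlipsIn S) : φ.eval ω' = φ.eval ω :=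
  eval_congr h.1 (fun f hf => h.2 f (Set.disjoint_left.1 hd hf)) hφ

theorem MForm.eval_agreeOff {S S' : Set ℕ} {ω ω' : FVar → Bool} (h : AgreeOff S' ω ω')
    (hd : Disjoint S S') {φ : MForm} (hφ : φ.FlipsIn S) : φ.eval ω' = φ.eval ω :=
  eval_congr h.1 (fun f hf => h.2 f (Set.disjoint_left.1 hd hf)) hφ

/-- The tuple has the shape of the type. -/
def MForm.HasShape : MForm → Ty → Prop
  | .leaf _, .bool => True
  | .pair φ ψ, .prod τ τ' => φ.HasShape τ ∧ ψ.HasShape τ'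
  | _, _ => False

theorem MForm.HasShape.hasType_eval (ω : FVar → Bool) :
    ∀ {φ : MForm} {τ : Ty}, φ.HasShape τ → HasType (φ.eval ω) τ
  | .leaf φ, .bool, _ => by
      simp only [eval]
      split_ifs
      · exact .tt
      · exact .ff
  | .pair _ _, .prod _ _, h => .pair (hasType_eval ω h.1) (hasType_eval ω h.2)

theorem MForm.hasShape_ofValue {v : Value} {τ : Ty} (h : HasType v τ) :
    (MForm.ofValue v).HasShape τ := by
  induction h with
  | tt => trivial
  | ff => trivial
  | pair _ _ h₁ h₂ => exact ⟨h₁, h₂⟩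

theorem MForm.eval_ofValue (ω : FVar → Bool) (v : Value) : (MForm.ofValue v).eval ω = v := by
  induction v with
  | tt => rfl
  | ff => rfl
  | pair v w h₁ h₂ => simp only [ofValue, eval, h₁, h₂]

theorem MForm.flipsIn_ofValue (S : Set ℕ) (v : Value) : (MForm.ofValue v).FlipsIn S := by
  induction v with
  | tt => trivial
  | ff => trivial
  | pair v w h₁ h₂ => exact ⟨h₁, h₂⟩

theorem hasShape_formF (τ : Ty) (x : Var) (p : List Side) : (formF τ x p).HasShape τ := by
  induction τ generalizing p with
  | bool => trivial
  | prod τ τ' h h' => exact ⟨h _, h' _⟩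

theorem flipsIn_formF (S : Set ℕ) (τ : Ty) (x : Var) (p : List Side) :
    (formF τ x p).FlipsIn S := by
  induction τ generalizing p with
  | bool => trivial
  | prod τ τ' h h' => exact ⟨h _, h' _⟩

theorem eval_formF_congr {ω ω' : FVar → Bool} {x : Var}
    (h : ∀ p, ω' (.comp x p) = ω (.comp x p)) (τ : Ty) (p : List Side) :
    (formF τ x p).eval ω' = (formF τ x p).eval ω := by
  induction τ generalizing p with
  | bool =>
    simp only [formF, MForm.eval, BForm.eval, h]
    rfl
  | prod τ τ' h h' => simp only [formF, MForm.eval, h, h']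

/-- The template of `x` reads one Boolean per position, so it evaluates to `χ` as soon as these
Booleans are the components of `χ`. The prefix `p` makes the induction on the type go through. -/
theorem eval_formF_of_at? {ω ω' : FVar → Bool} {x : Var} {χ : MForm} {τ : Ty} {p : List Side}
    (hχ : χ.HasShape τ)
    (h : ∀ q ψ, χ.at? q = some ψ → ω' (.comp x (p ++ q)) = ψ.eval ω) :
    (formF τ x p).eval ω' = χ.eval ω := by
  induction τ generalizing χ p with
  | bool =>
    obtain φ | _ := χ
    · have := h [] φ rfl
      rw [List.append_nil] at this
      simp only [formF, MForm.eval, BForm.eval, this]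
    · exact hχ.elim
  | prod τ τ' h₁ h₂ =>
    obtain _ | ⟨φ, ψ⟩ := χ
    · exact hχ.elim
    · simp only [formF, MForm.eval]
      rw [h₁ hχ.1 fun q ψ' hq => ?_, h₂ hχ.2 fun q ψ' hq => ?_]
      · simpa using h (.r :: q) ψ' (by simpa [MForm.at?] using hq)
      · simpa using h (.l :: q) ψ' (by simpa [MForm.at?] using hq)

theorem MForm.FlipsIn.at? {S : Set ℕ} :
    ∀ {χ : MForm} {p : List Side} {ψ : BForm}, χ.FlipsIn S → χ.at? p = some ψ → ψ.FlipsIn S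
  | .leaf φ, [], ψ, h, e => by
      simp only [MForm.at?, Option.some.injEq] at e
      exact e ▸ h
  | .pair φ ψ, .l :: p, _, h, e => at? (p := p) h.1 (by simpa only [MForm.at?] using e)
  | .pair φ ψ, .r :: p, _, h, e => at? (p := p) h.2 (by simpa only [MForm.at?] using e)
  | .leaf _, .l :: _, _, _, e => by simp [MForm.at?] at e
  | .leaf _, .r :: _, _, _, e => by simp [MForm.at?] at e
  | .pair _ _, [], _, _, e => by simp [MForm.at?] at e

/-! ### Substitution and renaming as changes of the assignment -/

/-- The assignment in which the components of `x` have the values of the components of `χ`. -/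
def substAssign (ω : FVar → Bool) (x : Var) (χ : MForm) : FVar → Bool
  | .comp y p =>
      if y = x then ((χ.at? p).map (BForm.eval ω)).getD (ω (.comp y p)) else ω (.comp y p)
  | .flip f => ω (.flip f)

theorem BForm.eval_subst (ω : FVar → Bool) (x : Var) (χ : MForm) :
    ∀ φ : BForm, (φ.subst x χ).eval ω = φ.eval (substAssign ω x χ)
  | .tt => rfl
  | .ff => rfl
  | .var (.comp y p) => by
      simp only [subst, eval, substAssign]
      split_ifs
      · cases χ.at? p <;> rfl
      · rfl
  | .var (.flip f) => rfl
  | .not φ => by simp only [subst, eval, eval_subst ω x χ φ]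
  | .and φ ψ => by simp only [subst, eval, eval_subst ω x χ φ, eval_subst ω x χ ψ]
  | .or φ ψ => by simp only [subst, eval, eval_subst ω x χ φ, eval_subst ω x χ ψ]

theorem MForm.eval_subst (ω : FVar → Bool) (x : Var) (χ : MForm) :
    ∀ φ : MForm, (φ.subst x χ).eval ω = φ.eval (substAssign ω x χ)
  | .leaf φ => by simp only [subst, eval, BForm.eval_subst]
  | .pair φ ψ => by simp only [subst, eval, eval_subst ω x χ φ, eval_subst ω x χ ψ]

theorem eval_formF_substAssign {χ : MForm} {τ : Ty} (h : χ.HasShape τ) (ω : FVar → Bool)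
    (x : Var) : (formF τ x []).eval (substAssign ω x χ) = χ.eval ω :=
  eval_formF_of_at? h fun q ψ hq => by simp [substAssign, hq]

/-- The components of `χ` do not mention `f`, so a later flip cannot disturb the value already bound
to `x`. -/
theorem substAssign_setFlip {χ : MForm} {S : Set ℕ} (h : χ.FlipsIn S) {f : ℕ} (hf : f ∉ S)
    (ω : FVar → Bool) (x : Var) (b : Bool) :
    substAssign (setFlip ω f b) x χ = setFlip (substAssign ω x χ) f b := by
  funext z
  cases z with
  | flip g => rfl
  | comp y p =>
    simp only [substAssign, setFlip]
    split_ifs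
    · cases e : χ.at? p with
      | none => rfl
      | some ψ =>
        simp only [Option.map_some, Option.getD_some]
        refine BForm.eval_congr (ω' := setFlip ω f b) (ω := ω) (fun _ _ => rfl) (fun g hg => ?_) (h.at? e)
        have : g ≠ f := fun e => hf (e ▸ hg)
        simp [setFlip, this]
    · rfl

theorem BForm.FlipsIn.subst {S : Set ℕ} {x : Var} {χ : MForm} (hχ : χ.FlipsIn S) :
    ∀ {φ : BForm}, φ.FlipsIn S → (φ.subst x χ).FlipsIn S
  | .tt, _ => trivial
  | .ff, _ => trivial
  | .var (.comp y p), _ => by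
      simp only [BForm.subst]
      split_ifs
      · cases e : χ.at? p with
        | none => trivial
        | some ψ => exact hχ.at? e
      · trivial
  | .var (.flip _), hf => hf
  | .not φ, hφ => subst (φ := φ) hχ hφ
  | .and _ _, hφ => ⟨subst hχ hφ.1, subst hχ hφ.2⟩
  | .or _ _, hφ => ⟨subst hχ hφ.1, subst hχ hφ.2⟩

theorem MForm.FlipsIn.subst {S : Set ℕ} {x : Var} {χ : MForm} (hχ : χ.FlipsIn S) :
    ∀ {φ : MForm}, φ.FlipsIn S → (φ.subst x χ).FlipsIn S
  | .leaf _, hφ => BForm.FlipsIn.subst hχ hφ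
  | .pair _ _, hφ => ⟨subst hχ hφ.1, subst hχ hφ.2⟩

theorem MForm.HasShape.subst {x : Var} {χ : MForm} :
    ∀ {φ : MForm} {τ : Ty}, φ.HasShape τ → (φ.subst x χ).HasShape τ
  | .leaf _, .bool, _ => trivial
  | .pair _ _, .prod _ _, h => ⟨subst h.1, subst h.2⟩

theorem BForm.FlipsIn.rename {S S' : Set ℕ} {ρ : ℕ → ℕ} (h : ∀ f ∈ S, ρ f ∈ S') :
    ∀ {φ : BForm}, φ.FlipsIn S → (φ.rename ρ).FlipsIn S'
  | .tt, _ => trivial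
  | .ff, _ => trivial
  | .var (.comp _ _), _ => trivial
  | .var (.flip _), hf => h _ hf
  | .not φ, hφ => rename (φ := φ) h hφ
  | .and _ _, hφ => ⟨rename h hφ.1, rename h hφ.2⟩
  | .or _ _, hφ => ⟨rename h hφ.1, rename h hφ.2⟩

theorem MForm.FlipsIn.rename {S S' : Set ℕ} {ρ : ℕ → ℕ} (h : ∀ f ∈ S, ρ f ∈ S') :
    ∀ {φ : MForm}, φ.FlipsIn S → (φ.rename ρ).FlipsIn S'
  | .leaf _, hφ => BForm.FlipsIn.rename h hφ
  | .pair _ _, hφ => ⟨rename h hφ.1, rename h hφ.2⟩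

theorem MForm.HasShape.rename {ρ : ℕ → ℕ} :
    ∀ {φ : MForm} {τ : Ty}, φ.HasShape τ → (φ.rename ρ).HasShape τ
  | .leaf _, .bool, _ => trivial
  | .pair _ _, .prod _ _, h => ⟨rename h.1, rename h.2⟩

/-- The assignment `ω` with renamed flip variables. -/
def renameAssign (ρ : ℕ → ℕ) (ω : FVar → Bool) : FVar → Bool
  | .comp x p => ω (.comp x p)
  | .flip f => ω (.flip (ρ f))

theorem BForm.eval_rename (ρ : ℕ → ℕ) (ω : FVar → Bool) :
    ∀ φ : BForm, (φ.rename ρ).eval ω = φ.eval (renameAssign ρ ω)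
  | .tt => rfl
  | .ff => rfl
  | .var (.comp _ _) => rfl
  | .var (.flip _) => rfl
  | .not φ => by simp only [rename, eval, eval_rename ρ ω φ]
  | .and φ ψ => by simp only [rename, eval, eval_rename ρ ω φ, eval_rename ρ ω ψ]
  | .or φ ψ => by simp only [rename, eval, eval_rename ρ ω φ, eval_rename ρ ω ψ]

theorem MForm.eval_rename (ρ : ℕ → ℕ) (ω : FVar → Bool) :
    ∀ φ : MForm, (φ.rename ρ).eval ω = φ.eval (renameAssign ρ ω)
  | .leaf φ => by simp only [rename, eval, BForm.eval_rename]
  | .pair φ ψ => by simp only [rename, eval, eval_rename ρ ω φ, eval_rename ρ ω ψ]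

/-! ### Conditionals on tuples of formulas -/

theorem MForm.FlipsIn.bAnd {S : Set ℕ} {g : BForm} (hg : g.FlipsIn S) :
    ∀ {φ : MForm}, φ.FlipsIn S → (φ.bAnd g).FlipsIn S
  | .leaf _, h => ⟨hg, h⟩
  | .pair _ _, h => ⟨bAnd hg h.1, bAnd hg h.2⟩

theorem MForm.FlipsIn.pOr {S : Set ℕ} :
    ∀ {φ ψ : MForm}, φ.FlipsIn S → ψ.FlipsIn S → (φ.pOr ψ).FlipsIn S
  | .leaf _, .leaf _, h, h' => ⟨h, h'⟩
  | .pair _ _, .pair _ _, h, h' => ⟨pOr h.1 h'.1, pOr h.2 h'.2⟩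
  | .leaf _, .pair _ _, h, _ => h
  | .pair _ _, .leaf _, h, _ => h

theorem MForm.HasShape.pOr_bAnd {g g' : BForm} :
    ∀ {φ ψ : MForm} {τ : Ty}, φ.HasShape τ → ψ.HasShape τ →
      ((φ.bAnd g).pOr (ψ.bAnd g')).HasShape τ
  | .leaf _, .leaf _, .bool, _, _ => trivial
  | .pair _ _, .pair _ _, .prod _ _, h, h' => ⟨pOr_bAnd h.1 h'.1, pOr_bAnd h.2 h'.2⟩
  | .leaf _, .pair _ _, .bool, _, h' => h'.elim
  | .leaf _, .pair _ _, .prod _ _, h, _ => h.elim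
  | .pair _ _, .leaf _, .bool, h, _ => h.elim
  | .pair _ _, .leaf _, .prod _ _, _, h' => h'.elim

theorem MForm.eval_ite (ω : FVar → Bool) (g : BForm) :
    ∀ {φ ψ : MForm} {τ : Ty}, φ.HasShape τ → ψ.HasShape τ →
      ((φ.bAnd g).pOr (ψ.bAnd (.not g))).eval ω = if g.eval ω then φ.eval ω else ψ.eval ω
  | .leaf _, .leaf _, .bool, _, _ => by
      cases h : g.eval ω <;> simp [bAnd, pOr, eval, BForm.eval, h]
  | .pair _ _, .pair _ _, .prod _ _, h, h' => by
      simp only [bAnd, pOr, eval, eval_ite ω g h.1 h'.1, eval_ite ω g h.2 h'.2]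
      split_ifs <;> rfl
  | .leaf _, .pair _ _, .bool, _, h' => h'.elim
  | .leaf _, .pair _ _, .prod _ _, h, _ => h.elim
  | .pair _ _, .leaf _, .bool, h, _ => h.elim
  | .pair _ _, .leaf _, .prod _ _, _, h' => h'.elim

/-! ### Closing substitutions -/

/-- Simultaneous substitution of values in an atomic expression. -/
def AExp.close (σ : Var → Option Value) : AExp → AExp
  | .var y => (σ y).elim (.var y) .val
  | .val w => .val w

/-- Simultaneous substitution of values in an expression. -/
def Expr.close (σ : Var → Option Value) : Expr → Expr
  | .atom a => .atom (a.close σ)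
  | .tup a b => .tup (a.close σ) (b.close σ)
  | .fst a => .fst (a.close σ)
  | .snd a => .snd (a.close σ)
  | .ite a e₁ e₂ => .ite (a.close σ) (e₁.close σ) (e₂.close σ)
  | .letIn y e₁ e₂ => .letIn y (e₁.close σ) (e₂.close (Function.update σ y none))
  | .call g a => .call g (a.close σ)
  | .flip θ => .flip θ
  | .nflip => .nflip
  | .observe a => .observe (a.close σ)

theorem AExp.subst_close (σ : Var → Option Value) (x : Var) (v : Value) (a : AExp) :
    (a.close (Function.update σ x none)).subst x v = a.close (Function.update σ x (some v)) := by
  cases a with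
  | val w => rfl
  | var y =>
    by_cases h : y = x
    · subst h; simp [close, AExp.subst]
    · simp only [close, Function.update_of_ne h]
      cases σ y <;> simp [AExp.subst, h]

/-- The semantics of `let` substitutes into a body that has already been closed with the bound
variable left free. This merges both operations into one closing substitution, to which an induction
hypothesis applies. -/
theorem Expr.subst_close (σ : Var → Option Value) (x : Var) (v : Value) (e : Expr) :
    (e.close (Function.update σ x none)).subst x v = e.close (Function.update σ x (some v)) := by
  induction e generalizing σ with
  | ite a e₁ e₂ h₁ h₂ => simp only [close, subst, AExp.subst_close, h₁, h₂]
  | letIn y e₁ e₂ h₁ h₂ =>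
    simp only [close, subst, h₁]
    by_cases h : y = x
    · subst h; simp
    -- The inner binder `y` and the variable `x` differ, so the two updates commute and the
    -- hypothesis for `e₂` can be used with `y` removed.
    · rw [if_neg h, Function.update_comm (Ne.symm h), h₂, Function.update_comm h]
  | _ => simp only [close, subst, AExp.subst_close]

theorem AExp.close_none (a : AExp) : a.close (fun _ => none) = a := by
  cases a <;> rfl

theorem Expr.close_none (e : Expr) : e.close (fun _ => none) = e := by
  have h (y : Var) : Function.update (fun _ : Var => (none : Option Value)) y none =
      fun _ => none := Function.update_eq_self y _
  induction e with
  | ite a e₁ e₂ h₁ h₂ => simp only [close, AExp.close_none, h₁, h₂]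
  | letIn y e₁ e₂ h₁ h₂ => simp only [close, h, h₁, h₂]
  | _ => simp only [close, AExp.close_none]

theorem Expr.subst_eq_close (x : Var) (v : Value) (e : Expr) :
    e.subst x v = e.close (Function.update (fun _ => none) x (some v)) := by
  rw [← subst_close, Function.update_eq_self x (fun _ : Var => (none : Option Value)), close_none]

/-! ### Expectations of sub-distributions -/

/-- The expected reward of a sub-distribution. -/
noncomputable def SubDist.expect (d : SubDist) (r : Value → ℝ) : ℝ :=
  ∑ v ∈ d.mass.support, d v * r v

theorem SubDist.expect_eq_sum (d : SubDist) (r : Value → ℝ) {s : Finset Value}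
    (h : d.mass.support ⊆ s) : d.expect r = ∑ v ∈ s, d v * r v :=
  Finset.sum_subset h fun v _ hv => by rw [Finsupp.notMem_support_iff.1 hv, zero_mul]

theorem SubDist.expect_one (d : SubDist) : d.expect (fun _ => 1) = d.total := by
  simp [expect, total]

theorem SubDist.expect_mono (d : SubDist) {r r' : Value → ℝ}
    (h : ∀ v, 0 < d v → r v ≤ r' v) : d.expect r ≤ d.expect r' := by
  refine Finset.sum_le_sum fun v hv => mul_le_mul_of_nonneg_left (h v ?_) (d.nonneg v)
  exact lt_of_le_of_ne (d.nonneg v) (Ne.symm (Finsupp.mem_support_iff.1 hv))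

theorem SubDist.expect_congr (d : SubDist) {r r' : Value → ℝ}
    (h : ∀ v, 0 < d v → r v = r' v) : d.expect r = d.expect r' :=
  le_antisymm (d.expect_mono fun v hv => (h v hv).le) (d.expect_mono fun v hv => (h v hv).ge)

theorem SubDist.expect_add_mul (d : SubDist) (r r' : Value → ℝ) (c : ℝ) :
    d.expect (fun v => r v + c * r' v) = d.expect r + c * d.expect r' := by
  simp only [expect, Finset.mul_sum, ← Finset.sum_add_distrib]
  exact Finset.sum_congr rfl fun v _ => by ring

theorem SubDist.expect_single (d : SubDist) (v : Value) :
    d.expect (fun w => if w = v then 1 else 0) = d v := by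
  by_cases h : v ∈ d.mass.support
  · simp only [expect, mul_ite, mul_one, mul_zero, Finset.sum_ite_eq', h, if_true]
  · simp only [expect, mul_ite, mul_one, mul_zero, Finset.sum_ite_eq', h, if_false]
    exact (Finsupp.notMem_support_iff.1 h).symm

/-- The sub-distribution with the given mass function on a finite set. -/
noncomputable def SubDist.ofFinset (s : Finset Value) (m : Value → ℝ) (h₀ : ∀ v, 0 ≤ m v)
    (hs : ∀ v, v ∉ s → m v = 0) (h₁ : ∑ v ∈ s, m v ≤ 1) : SubDist where
  mass := Finsupp.onFinset s m fun v hv => by_contra fun h => hv (hs v h)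
  nonneg := h₀
  sum_le_one := by
    refine (Finset.sum_subset Finsupp.support_onFinset_subset fun v _ hv => ?_).trans_le h₁
    exact Finsupp.notMem_support_iff.1 hv

theorem expect_of_mem_dirac {v : Value} {d : SubDist} (h : d ∈ dirac v) (r : Value → ℝ) :
    d.expect r = r v := by
  have hs : d.mass.support ⊆ {v} := fun w hw => by
    have := Finsupp.mem_support_iff.1 hw
    rw [h w] at this
    simpa using this
  have hv : d v = 1 := by rw [h v, if_pos rfl]
  rw [d.expect_eq_sum r hs, Finset.sum_singleton, hv, one_mul]

theorem dirac_nonempty (v : Value) : (dirac v).Nonempty :=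
  ⟨.ofFinset {v} (fun w => if w = v then 1 else 0) (fun w => by split_ifs <;> norm_num)
    (fun w hw => if_neg (by simpa using hw)) (by simp), fun _ => rfl⟩

theorem expect_of_mem_coin {θ : ℝ} {d : SubDist} (h : d ∈ coin θ) (r : Value → ℝ) :
    d.expect r = θ * r .tt + (1 - θ) * r .ff := by
  have hs : d.mass.support ⊆ {.tt, .ff} := fun w hw => by
    have := Finsupp.mem_support_iff.1 hw
    rw [h w] at this
    by_contra hw'
    simp only [Finset.mem_insert, Finset.mem_singleton, not_or] at hw'
    simp [hw'] at this
  have ht : d .tt = θ := by rw [h, if_pos rfl]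
  have hf : d .ff = 1 - θ := by rw [h, if_neg (by decide), if_pos rfl]
  rw [d.expect_eq_sum r hs, Finset.sum_pair (by decide), ht, hf]

theorem coin_nonempty {θ : ℝ} (h₀ : 0 ≤ θ) (h₁ : θ ≤ 1) : (coin θ).Nonempty :=
  ⟨.ofFinset {.tt, .ff} (fun w => if w = .tt then θ else if w = .ff then 1 - θ else 0)
    (fun w => by split_ifs <;> linarith)
    (fun w hw => by
      simp only [Finset.mem_insert, Finset.mem_singleton, not_or] at hw
      simp [hw])
    (by rw [Finset.sum_pair (by decide)]; simp), fun _ => rfl⟩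

/-- The set of expected rewards of a set of sub-distributions. -/
def rewards (S : Set SubDist) (r : Value → ℝ) : Set ℝ := {x | ∃ d ∈ S, x = d.expect r}

theorem isGreatest_rewards_dirac (v : Value) (r : Value → ℝ) :
    IsGreatest (rewards (dirac v) r) (r v) := by
  obtain ⟨d, hd⟩ := dirac_nonempty v
  refine ⟨⟨d, hd, (expect_of_mem_dirac hd r).symm⟩, ?_⟩
  rintro _ ⟨d, hd, rfl⟩
  exact (expect_of_mem_dirac hd r).le

theorem isGreatest_rewards_zero (r : Value → ℝ) :
    IsGreatest (rewards {d | ∀ w, d w = 0} r) 0 := by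
  have h (d : SubDist) (hd : ∀ w, d w = 0) : d.expect r = 0 :=
    Finset.sum_eq_zero fun v _ => by rw [hd, zero_mul]
  refine ⟨⟨.ofFinset ∅ (fun _ => 0) (fun _ => le_rfl) (fun _ _ => rfl) (by simp),
    fun _ => rfl, (h _ fun _ => rfl).symm⟩, ?_⟩
  rintro _ ⟨d, hd, rfl⟩
  exact (h d hd).le

theorem isGreatest_rewards_coin {θ : ℝ} (h₀ : 0 ≤ θ) (h₁ : θ ≤ 1) (r : Value → ℝ) :
    IsGreatest (rewards (coin θ) r) (θ * r .tt + (1 - θ) * r .ff) := by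
  obtain ⟨d, hd⟩ := coin_nonempty h₀ h₁
  refine ⟨⟨d, hd, (expect_of_mem_coin hd r).symm⟩, ?_⟩
  rintro _ ⟨d, hd, rfl⟩
  exact (expect_of_mem_coin hd r).le

/-- The expected reward is affine in θ, so an endpoint of `[0,1]` is optimal. -/
theorem isGreatest_rewards_nflip (r : Value → ℝ) :
    IsGreatest (rewards {d | ∃ θ ∈ Set.Icc (0 : ℝ) 1, d ∈ coin θ} r) (max (r .tt) (r .ff)) := by
  constructor
  · rcases le_total (r .tt) (r .ff) with h | h
    · obtain ⟨d, hd⟩ := coin_nonempty (θ := 0) le_rfl zero_le_one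
      exact ⟨d, ⟨0, by simp, hd⟩, by rw [expect_of_mem_coin hd, max_eq_right h]; ring⟩
    · obtain ⟨d, hd⟩ := coin_nonempty (θ := 1) zero_le_one le_rfl
      exact ⟨d, ⟨1, by simp, hd⟩, by rw [expect_of_mem_coin hd, max_eq_left h]; ring⟩
  · rintro _ ⟨d, ⟨θ, hθ, hd⟩, rfl⟩
    rw [expect_of_mem_coin hd]
    have h₁ := mul_le_mul_of_nonneg_left (le_max_left (r .tt) (r .ff)) hθ.1
    have h₂ := mul_le_mul_of_nonneg_left (le_max_right (r .tt) (r .ff)) (sub_nonneg.2 hθ.2)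
    linarith

/-- The mixtures of sub-distributions that give the semantics of `let`. -/
def bindSet (S : Set SubDist) (F : Value → Set SubDist) : Set SubDist :=
  {d | ∃ d₁ ∈ S, ∃ D : Value → SubDist, (∀ v, 0 < d₁ v → D v ∈ F v) ∧
    ∀ v', d v' = ∑ v ∈ d₁.mass.support, d₁ v * D v v'}

/-- The tower rule for mixtures. All supports are enlarged to a common finite set so that the two
sums can be exchanged. -/
theorem expect_of_eq_sum {d d₁ : SubDist} {D : Value → SubDist}
    (h : ∀ v', d v' = ∑ v ∈ d₁.mass.support, d₁ v * D v v') (r : Value → ℝ) :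
    d.expect r = d₁.expect fun v => (D v).expect r := by
  classical
  set s := d.mass.support ∪ d₁.mass.support.biUnion fun v => (D v).mass.support with hs
  rw [d.expect_eq_sum r (s := s) Finset.subset_union_left]
  have (v : Value) (hv : v ∈ d₁.mass.support) : (D v).expect r = ∑ w ∈ s, D v w * r w :=
    (D v).expect_eq_sum r ((Finset.subset_biUnion_of_mem (fun v => (D v).mass.support) hv).trans
      Finset.subset_union_right)
  have e : d₁.expect (fun v => (D v).expect r) =
      ∑ v ∈ d₁.mass.support, ∑ w ∈ s, d₁ v * (D v w * r w) :=
    Finset.sum_congr rfl fun v hv => by simp only [this v hv, Finset.mul_sum]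
  rw [e, Finset.sum_comm]
  refine Finset.sum_congr rfl fun w _ => ?_
  rw [h, Finset.sum_mul]
  exact Finset.sum_congr rfl fun v _ => by ring

theorem exists_eq_sum (d₁ : SubDist) (D : Value → SubDist) :
    ∃ d : SubDist, ∀ v', d v' = ∑ v ∈ d₁.mass.support, d₁ v * D v v' := by
  classical
  refine ⟨.ofFinset (d₁.mass.support.biUnion fun v => (D v).mass.support)
    (fun v' => ∑ v ∈ d₁.mass.support, d₁ v * D v v') (fun v' => ?_) (fun v' hv' => ?_) ?_,
    fun _ => rfl⟩
  · exact Finset.sum_nonneg fun v _ => mul_nonneg (d₁.nonneg v) ((D v).nonneg v')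
  · refine Finset.sum_eq_zero fun v hv => ?_
    have : v' ∉ (D v).mass.support := fun h => hv' (Finset.mem_biUnion.2 ⟨v, hv, h⟩)
    rw [Finsupp.notMem_support_iff.1 this, mul_zero]
  · rw [Finset.sum_comm]
    refine (Finset.sum_le_sum fun v hv => ?_).trans d₁.sum_le_one
    rw [← Finset.mul_sum]
    refine mul_le_of_le_one_right (d₁.nonneg v) (le_trans (le_of_eq ?_) (D v).sum_le_one)
    refine (Finset.sum_subset (Finset.subset_biUnion_of_mem
      (fun v => (D v).mass.support) hv) fun w _ hw => ?_).symm
    exact Finsupp.notMem_support_iff.1 hw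

/-- The dynamic programming principle. The continuations for different values are chosen
independently, so each can be taken optimal; the first stage is then optimal for the continuation
rewards `r₁`. Only values in the support matter, which is why `hF` is restricted to them. -/
theorem isGreatest_rewards_bindSet {S : Set SubDist} {F : Value → Set SubDist}
    {r r₁ : Value → ℝ} {m : ℝ} (hS : IsGreatest (rewards S r₁) m)
    (hF : ∀ d₁ ∈ S, ∀ v, 0 < d₁ v → IsGreatest (rewards (F v) r) (r₁ v)) :
    IsGreatest (rewards (bindSet S F) r) m := by
  constructor
  · obtain ⟨d₁, hd₁, rfl⟩ := hS.1
    have (v : Value) : ∃ D : SubDist, 0 < d₁ v → D ∈ F v ∧ r₁ v = D.expect r := by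
      by_cases h : 0 < d₁ v
      · obtain ⟨D, hD, e⟩ := (hF d₁ hd₁ v h).1
        exact ⟨D, fun _ => ⟨hD, e⟩⟩
      -- Outside the support nothing is required, and `d₁` is an arbitrary filler.
      · exact ⟨d₁, fun h' => (h h').elim⟩
    choose D hD using this
    obtain ⟨d, hd⟩ := exists_eq_sum d₁ D
    exact ⟨d, ⟨d₁, hd₁, D, fun v hv => (hD v hv).1, hd⟩, by
      rw [expect_of_eq_sum hd]
      exact d₁.expect_congr fun v hv => (hD v hv).2⟩
  · rintro _ ⟨d, ⟨d₁, hd₁, D, hD, hd⟩, rfl⟩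
    rw [expect_of_eq_sum hd]
    exact (d₁.expect_mono fun v hv => (hF d₁ hd₁ v hv).2 ⟨_, hD v hv, rfl⟩).trans
      (hS.2 ⟨d₁, hd₁, rfl⟩)

/-! ### Optimal rewards of compiled expressions -/

/-- The reward of the value of `φ`, if `γ` holds. -/
noncomputable def guardedReward (φ : MForm) (γ : BForm) (r : Value → ℝ) (ω : FVar → Bool) : ℝ :=
  if γ.eval ω then r (φ.eval ω) else 0

/-- The closing substitution `σ` is the one given by the assignment `ω`. -/
def Agree (Γ : TyEnv) (σ : Var → Option Value) (ω : FVar → Bool) : Prop :=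
  ∀ x τ, Γ.var x = some τ → σ x = some ((formF τ x []).eval ω)

theorem Agree.of_agreeOff {Γ : TyEnv} {σ : Var → Option Value} {ω ω' : FVar → Bool} {S : Set ℕ}
    (h : Agree Γ σ ω) (hω : AgreeOff S ω ω') : Agree Γ σ ω' := fun x τ hx => by
  rw [h x τ hx, eval_formF_congr fun p => hω.1 x p]

theorem Agree.addVar {Γ : TyEnv} {σ : Var → Option Value} {ω : FVar → Bool} (h : Agree Γ σ ω)
    (x : Var) {τ : Ty} {χ : MForm} (hχ : χ.HasShape τ) :
    Agree (Γ.addVar x τ) (Function.update σ x (some (χ.eval ω))) (substAssign ω x χ) := by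
  intro y τ' hy
  by_cases e : y = x
  · subst e
    simp only [TyEnv.addVar, Function.update_self, Option.some.injEq] at hy
    subst hy
    rw [Function.update_self, eval_formF_substAssign hχ]
  · simp only [TyEnv.addVar, Function.update_of_ne e] at hy
    rw [Function.update_of_ne e, h y τ' hy]
    congr 1
    exact (eval_formF_congr (fun p => by simp [substAssign, e]) _ _).symm

/-- The invariants of the triple `(φ, γ, t)` produced by a compilation with type `τ`. -/
structure WellFormed (τ : Ty) (φ : MForm) (γ : BForm) (t : Trace) : Prop where
  shape : φ.HasShape τ
  flips : φ.FlipsIn {f | f ∈ t.flips}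
  acc : γ.FlipsIn {f | f ∈ t.flips}
  nodup : t.flips.Nodup

/-- The compiled functions are correct with respect to the semantics of the functions. -/
def TableCorrect (Γ : TyEnv) (Φ : CompTable) (T : FunTable) : Prop :=
  ∀ g τ₁ τ₂ c, Γ.fn g = some (τ₁, τ₂) → Φ g = some c →
    WellFormed τ₂ c.model c.acc c.trace ∧
    ∃ F, T g = some F ∧ ∀ ω r, IsGreatest (rewards (F ((formF τ₁ c.arg []).eval ω)) r)
      (opt c.trace (guardedReward c.model c.acc r) ω)

theorem CompA.hasShape {Γ : TyEnv} {a : AExp} {τ : Ty} {φ : MForm} (h : CompA Γ a τ φ) :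
    φ.HasShape τ := by
  cases h with
  | val h => exact MForm.hasShape_ofValue h
  | ident _ => exact hasShape_formF _ _ _

theorem CompA.flipsIn {Γ : TyEnv} {a : AExp} {τ : Ty} {φ : MForm} (h : CompA Γ a τ φ)
    (S : Set ℕ) : φ.FlipsIn S := by
  cases h with
  | val h => exact MForm.flipsIn_ofValue _ _
  | ident _ => exact flipsIn_formF _ _ _ _

theorem CompA.close_eq {Γ : TyEnv} {a : AExp} {τ : Ty} {φ : MForm} (h : CompA Γ a τ φ)
    {σ : Var → Option Value} {ω : FVar → Bool} (hσ : Agree Γ σ ω) :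
    a.close σ = .val (φ.eval ω) := by
  cases h with
  | val h => rw [MForm.eval_ofValue]; rfl
  | ident h => simp only [AExp.close, hσ _ _ h, Option.elim_some]

theorem Trace.flips_append (t₁ t₂ : Trace) : Trace.flips (t₁ ++ t₂) = t₁.flips ++ t₂.flips :=
  List.map_append

theorem Trace.flips_rename (ρ : ℕ → ℕ) (t : Trace) : (t.rename ρ).flips = t.flips.map ρ := by
  simp [Trace.flips, Trace.rename, Function.comp_def]

/-- Disjointness of traces and injectivity of renamings keep the flips distinct. The table is
consulted only for the invariants of called functions. -/
theorem wellFormed_of_comp {Φ : CompTable} {T : FunTable} {Γ : TyEnv} {e : Expr} {τ : Ty}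
    {φ : MForm} {γ : BForm} {t : Trace} (h : Comp Φ Γ e τ φ γ t) (hT : TableCorrect Γ Φ T) :
    WellFormed τ φ γ t := by
  have left (t₁ t₂ : Trace) : {f | f ∈ t₁.flips} ⊆ {f | f ∈ Trace.flips (t₁ ++ t₂)} :=
    fun f hf => by rw [Trace.flips_append]; exact List.mem_append_left _ hf
  have right (t₁ t₂ : Trace) : {f | f ∈ t₂.flips} ⊆ {f | f ∈ Trace.flips (t₁ ++ t₂)} :=
    fun f hf => by rw [Trace.flips_append]; exact List.mem_append_right _ hf
  induction h with
  | atom ha => exact ⟨ha.hasShape, ha.flipsIn _, trivial, List.nodup_nil⟩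
  | flip f θ => exact ⟨trivial, List.mem_singleton_self f, trivial, List.nodup_singleton _⟩
  | nflip f => exact ⟨trivial, List.mem_singleton_self f, trivial, List.nodup_singleton _⟩
  | tup ha hb =>
    exact ⟨⟨ha.hasShape, hb.hasShape⟩, ⟨ha.flipsIn _, hb.flipsIn _⟩, trivial, List.nodup_nil⟩
  | observe ha => exact ⟨trivial, trivial, ha.flipsIn _, List.nodup_nil⟩
  | fst ha => exact ⟨ha.hasShape.1, (ha.flipsIn _).1, trivial, List.nodup_nil⟩
  | snd ha => exact ⟨ha.hasShape.2, (ha.flipsIn _).2, trivial, List.nodup_nil⟩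
  | @ite Γ a e₁ e₂ τ g φ₁ φ₂ γ₁ γ₂ t₁ t₂ ha _ _ hd ih₁ ih₂ =>
    have w₁ := ih₁ hT
    have w₂ := ih₂ hT
    have hg : ∀ S, g.FlipsIn S := fun S => ha.flipsIn S
    exact ⟨w₁.shape.pOr_bAnd w₂.shape,
      (MForm.FlipsIn.bAnd (hg _) (w₁.flips.mono (left t₁ t₂))).pOr 
        (MForm.FlipsIn.bAnd (g := .not g) (hg _) (w₂.flips.mono (right t₁ t₂))),
      ⟨⟨hg _, w₁.acc.mono (left t₁ t₂)⟩, ⟨hg _, w₂.acc.mono (right t₁ t₂)⟩⟩,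
      by rw [Trace.flips_append]; exact w₁.nodup.append w₂.nodup hd⟩
  | @letIn Γ x e₁ e₂ τ₁ τ₂ φ₁ φ₂ γ₁ γ₂ t₁ t₂ _ _ hd ih₁ ih₂ =>
    have w₁ := ih₁ hT
    have w₂ := ih₂ hT
    exact ⟨w₂.shape.subst,
      (w₁.flips.mono (left t₁ t₂)).subst (w₂.flips.mono (right t₁ t₂)),
      ⟨w₁.acc.mono (left t₁ t₂),
        BForm.FlipsIn.subst (w₁.flips.mono (left t₁ t₂)) (w₂.acc.mono (right t₁ t₂))⟩,
      by rw [Trace.flips_append]; exact w₁.nodup.append w₂.nodup hd⟩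
  | @call Γ g a τ₁ τ₂ χ c ρ ha hg hc hρ =>
    have w := (hT g τ₁ τ₂ c hg hc).1
    have hρ' : ∀ f ∈ {f | f ∈ c.trace.flips}, ρ f ∈ {f | f ∈ (c.trace.rename ρ).flips} :=
      fun f hf => by rw [Set.mem_ofPred_eq, Trace.flips_rename]; exact List.mem_map_of_mem hf
    exact ⟨w.shape.rename.subst, (ha.flipsIn _).subst (w.flips.rename hρ'),
      BForm.FlipsIn.subst (ha.flipsIn _) (w.acc.rename hρ'),
      by rw [Trace.flips_rename]; exact w.nodup.map_on fun x hx y hy e => hρ hx hy e⟩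

/-! ### Optimal values for conditionals, bindings and calls -/

/-- The guard mentions no flips, so it keeps its value while both traces are performed. The flips of
the untaken branch are performed too, but the selected formulas do not read them. -/
theorem opt_ite {t₁ t₂ : Trace} {τ : Ty} {g : BForm} {φ₁ φ₂ : MForm} {γ₁ γ₂ : BForm}
    (hg : g.FlipsIn ∅) (w₁ : WellFormed τ φ₁ γ₁ t₁) (w₂ : WellFormed τ φ₂ γ₂ t₂)
    (hd : List.Disjoint t₁.flips t₂.flips) (r : Value → ℝ) (ω : FVar → Bool) :
    opt (t₁ ++ t₂) (guardedReward (.pOr (.bAnd g φ₁) (.bAnd (.not g) φ₂))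
      (.or (.and g γ₁) (.and (.not g) γ₂)) r) ω =
    if g.eval ω then opt t₁ (guardedReward φ₁ γ₁ r) ω else opt t₂ (guardedReward φ₂ γ₂ r) ω := by
  have hd' : Disjoint {f | f ∈ t₁.flips} {f | f ∈ t₂.flips} :=
    Set.disjoint_left.2 fun f h₁ h₂ => hd h₁ h₂
  have key : guardedReward (.pOr (.bAnd g φ₁) (.bAnd (.not g) φ₂))
      (.or (.and g γ₁) (.and (.not g) γ₂)) r = fun ω => if g.eval ω then
        guardedReward φ₁ γ₁ r ω else guardedReward φ₂ γ₂ r ω := by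
    funext ω
    simp only [guardedReward, MForm.eval_ite ω g w₁.shape w₂.shape, BForm.eval]
    cases g.eval ω <;> simp
  rw [key, opt_append]
  split_ifs with h
  -- Guard true: once `t₁` is done the reward is fixed, so the flips of `t₂` are idle.
  · refine opt_congr fun ω₁ h₁ => opt_eq_const fun ω₂ h₂ => ?_
    simp only [BForm.eval_agreeOff h₂ (Set.empty_disjoint _) hg,
      BForm.eval_agreeOff h₁ (Set.empty_disjoint _) hg, h, if_true, guardedReward,
      BForm.eval_agreeOff h₂ hd' w₁.acc, MForm.eval_agreeOff h₂ hd' w₁.flips]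
  -- Guard false: the flips of `t₁` come first, and the optimum over `t₂` does not depend on their
  -- outcomes. The relation lets the two runs of `t₂` differ exactly on the flips of `t₁`, which the
  -- else-branch never reads.
  · refine opt_eq_const fun ω₁ h₁ => ?_
    refine opt_eq_of_rel t₂ (fun ω ω' => (∀ x p, ω (.comp x p) = ω' (.comp x p)) ∧
      g.eval ω = false ∧ ∀ f, f ∉ t₁.flips → ω (.flip f) = ω' (.flip f)) ?_ ?_
      ⟨h₁.1, by rwa [BForm.eval_agreeOff h₁ (Set.empty_disjoint _) hg, ← Bool.not_eq_true], h₁.2⟩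
    · rintro f hf b ω ω' ⟨h₁, h₂, h₃⟩
      refine ⟨h₁, ?_, fun f' hf' => ?_⟩
      · rw [← h₂]
        exact BForm.eval_congr (S := ∅) (ω' := setFlip ω f b) (ω := ω) (fun _ _ => rfl) (fun _ h => h.elim) hg
      · simp only [setFlip]
        split_ifs
        · rfl
        · exact h₃ f' hf'
    · rintro ω ω' ⟨h₁, h₂, h₃⟩
      have h₄ : ∀ f ∈ {f | f ∈ t₂.flips}, ω (.flip f) = ω' (.flip f) :=
        fun f hf => h₃ f fun hf' => hd hf' hf
      simp only [h₂, Bool.false_eq_true, if_false, guardedReward,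
        BForm.eval_congr h₁ h₄ w₂.acc, MForm.eval_congr h₁ h₄ w₂.flips]

theorem guardedReward_subst (φ : MForm) (γ : BForm) (x : Var) (χ : MForm) (r : Value → ℝ)
    (ω : FVar → Bool) :
    guardedReward (φ.subst x χ) (γ.subst x χ) r ω = guardedReward φ γ r (substAssign ω x χ) := by
  simp only [guardedReward, BForm.eval_subst, MForm.eval_subst]

/-- If `γ₁` fails after `t₁`, the reward is 0 whatever `t₂` does; otherwise the optimum over `t₂` is
the continuation value of the bound result. The hypothesis `hr₁` says that this value depends on the
earlier flips only through the value of `φ₁`. -/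
theorem opt_letIn {t₁ t₂ : Trace} {x : Var} {τ₁ : Ty} {φ₁ φ₂ : MForm} {γ₁ γ₂ : BForm}
    (w₁ : WellFormed τ₁ φ₁ γ₁ t₁) (hd : List.Disjoint t₁.flips t₂.flips) (r r₁ : Value → ℝ) (ω : FVar → Bool)
    (hr₁ : ∀ ω₁, AgreeOff {f | f ∈ t₁.flips} ω ω₁ →
      opt t₂ (guardedReward φ₂ γ₂ r) (substAssign ω₁ x φ₁) = r₁ (φ₁.eval ω₁)) :
    opt (t₁ ++ t₂) (guardedReward (φ₂.subst x φ₁) (.and γ₁ (γ₂.subst x φ₁)) r) ω =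
      opt t₁ (guardedReward φ₁ γ₁ r₁) ω := by
  have hd' : Disjoint {f | f ∈ t₁.flips} {f | f ∈ t₂.flips} :=
    Set.disjoint_left.2 fun f h₁ h₂ => hd h₁ h₂
  rw [opt_append]
  refine opt_congr fun ω₁ h₁ => ?_
  have key : ∀ ω₂, guardedReward (φ₂.subst x φ₁) (.and γ₁ (γ₂.subst x φ₁)) r ω₂ =
      if γ₁.eval ω₂ then guardedReward φ₂ γ₂ r (substAssign ω₂ x φ₁) else 0 := fun ω₂ => by
    rw [← guardedReward_subst]
    simp only [guardedReward, BForm.eval]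
    by_cases h : γ₁.eval ω₂ = true <;> simp [h]
  by_cases h : γ₁.eval ω₁ = true
  · rw [guardedReward, if_pos h, ← hr₁ ω₁ h₁]
    have : opt t₂ (guardedReward (φ₂.subst x φ₁) (.and γ₁ (γ₂.subst x φ₁)) r) ω₁ =
        opt t₂ (fun ω₂ => guardedReward φ₂ γ₂ r (substAssign ω₂ x φ₁)) ω₁ :=
      opt_congr fun ω₂ h₂ => by
        rw [key, if_pos (by rwa [BForm.eval_agreeOff h₂ hd' w₁.acc])]
    rw [this]
    refine opt_eq_of_rel t₂ (fun ω₂ ω₂' => ω₂' = substAssign ω₂ x φ₁) ?_ ?_ rfl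
    · rintro f hf b ω₂ _ rfl
      exact (substAssign_setFlip w₁.flips (fun hf' => hd hf' hf) _ _ _).symm
    · rintro ω₂ _ rfl
      rfl
  · rw [guardedReward, if_neg h]
    exact opt_eq_const fun ω₂ h₂ => by
      rw [key, if_neg (by rwa [BForm.eval_agreeOff h₂ hd' w₁.acc])]

/-- Performing the renamed flips with the argument substituted mirrors performing the original flips
from an assignment in which the parameter already holds the argument. -/
theorem opt_call {t : Trace} {x : Var} {τ : Ty} {φ χ : MForm} {γ : BForm} {ρ : ℕ → ℕ}
    (w : WellFormed τ φ γ t) (hχ : χ.FlipsIn ∅) (hρ : Set.InjOn ρ {f | f ∈ t.flips})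
    (r : Value → ℝ) (ω : FVar → Bool) :
    opt (t.rename ρ) (guardedReward ((φ.rename ρ).subst x χ) ((γ.rename ρ).subst x χ) r) ω =
      opt t (guardedReward φ γ r) (renameAssign ρ (substAssign ω x χ)) := by
  refine opt_rename_of_rel ρ t (fun ω ω' =>
    (∀ y p, renameAssign ρ (substAssign ω x χ) (.comp y p) = ω' (.comp y p)) ∧
    ∀ f ∈ {f | f ∈ t.flips}, ω (.flip (ρ f)) = ω' (.flip f)) ?_ ?_
    ⟨fun _ _ => rfl, fun _ _ => rfl⟩
  · rintro f hf b ω ω' ⟨h₁, h₂⟩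
    refine ⟨fun y p => ?_, fun f' hf' => ?_⟩
    · rw [substAssign_setFlip hχ (Set.notMem_empty _)]
      exact h₁ y p
    · simp only [setFlip]
      by_cases e : f' = f
      · subst e; simp
      -- Injectivity is needed here: setting `ρ f` must leave the images of the other flips
      -- unchanged.
      · rw [if_neg e, if_neg fun e' => e (hρ hf' hf e')]
        exact h₂ f' hf'
  · rintro ω ω' ⟨h₁, h₂⟩
    rw [guardedReward_subst, guardedReward, guardedReward, BForm.eval_rename, MForm.eval_rename,
      BForm.eval_congr h₁ h₂ w.acc, MForm.eval_congr h₁ h₂ w.flips]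

/-- Type soundness read off from optimality. For the indicator of an ill-typed `v` the optimum is 0,
because `φ` only evaluates to values of type `τ`; hence no `d` in `S` gives `v` positive mass. -/
theorem hasType_of_isGreatest {S : Set SubDist} {τ : Ty} {φ : MForm} {γ : BForm} {t : Trace}
    (w : WellFormed τ φ γ t) {ω : FVar → Bool}
    (h : ∀ r, IsGreatest (rewards S r) (opt t (guardedReward φ γ r) ω)) {d : SubDist} (hd : d ∈ S)
    {v : Value} (hv : 0 < d v) : HasType v τ := by
  by_contra hτ
  have h' := (h fun w => if w = v then 1 else 0).2 ⟨d, hd, rfl⟩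
  rw [d.expect_single, opt_eq_const (c := 0)] at h'
  · exact hv.not_ge h'
  · intro ω' _
    have : φ.eval ω' ≠ v := fun e => hτ (e ▸ w.shape.hasType_eval ω')
    simp [guardedReward, this]

theorem sem_call {T : FunTable} {g : Fn} {F : Value → Set SubDist} (h : T g = some F)
    (v : Value) : sem T (.call g (.val v)) = F v := by
  rw [sem]
  exact h

/-- The semantic core, by induction on the compilation. It has to hold for all rewards and
assignments: the `let` case replaces the reward by continuation values and evaluates the body under
changed assignments. -/
theorem isGreatest_rewards_sem {Φ : CompTable} {T : FunTable} {Γ : TyEnv} {e : Expr} {τ : Ty}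
    {φ : MForm} {γ : BForm} {t : Trace} (h : Comp Φ Γ e τ φ γ t) (hT : TableCorrect Γ Φ T)
    {σ : Var → Option Value} {ω : FVar → Bool} (hσ : Agree Γ σ ω) (r : Value → ℝ) :
    IsGreatest (rewards (sem T (e.close σ)) r) (opt t (guardedReward φ γ r) ω) := by
  induction h generalizing σ ω r with
  | atom ha =>
    rw [Expr.close, ha.close_eq hσ, sem]
    exact isGreatest_rewards_dirac _ _
  | flip f θ =>
    rw [Expr.close, sem]
    convert isGreatest_rewards_coin (θ := ((θ : ℚ) : ℝ)) (by exact_mod_cast θ.2.1)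
      (by exact_mod_cast θ.2.2) r using 1
    simp [opt, FlipKind.combine, guardedReward, BForm.eval, MForm.eval, setFlip]
  | nflip f =>
    rw [Expr.close, sem]
    convert isGreatest_rewards_nflip r using 1
    simp [opt, FlipKind.combine, guardedReward, BForm.eval, MForm.eval, setFlip]
  | tup ha hb =>
    rw [Expr.close, ha.close_eq hσ, hb.close_eq hσ, sem]
    exact isGreatest_rewards_dirac _ _
  | @observe Γ a φ ha =>
    rw [Expr.close, ha.close_eq hσ]
    simp only [MForm.eval, opt, guardedReward, BForm.eval]
    cases φ.eval ω
    · simp only [Bool.false_eq_true, if_false, sem]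
      exact isGreatest_rewards_zero r
    · simp only [if_true, sem]
      exact isGreatest_rewards_dirac _ _
  | fst ha =>
    rw [Expr.close, ha.close_eq hσ, MForm.eval, sem]
    exact isGreatest_rewards_dirac _ _
  | snd ha =>
    rw [Expr.close, ha.close_eq hσ, MForm.eval, sem]
    exact isGreatest_rewards_dirac _ _
  | @ite Γ a e₁ e₂ τ g φ₁ φ₂ γ₁ γ₂ t₁ t₂ ha h₁ h₂ hd ih₁ ih₂ =>
    rw [Expr.close, ha.close_eq hσ, opt_ite (ha.flipsIn ∅) (wellFormed_of_comp h₁ hT)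
      (wellFormed_of_comp h₂ hT) hd]
    simp only [MForm.eval]
    cases g.eval ω
    · simp only [Bool.false_eq_true, if_false, sem]
      exact ih₂ hT hσ r
    · simp only [if_true, sem]
      exact ih₁ hT hσ r
  | @letIn Γ x e₁ e₂ τ₁ τ₂ φ₁ φ₂ γ₁ γ₂ t₁ t₂ h₁ h₂ hd ih₁ ih₂ =>
    have w₁ := wellFormed_of_comp h₁ hT
    -- The continuation value of `v`, computed from the initial `ω` rather than from the assignment
    -- reached after `t₁`; the discrepancy is resolved at the end of this case.
    set r₁ : Value → ℝ := fun v =>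
      opt t₂ (guardedReward φ₂ γ₂ r) (substAssign ω x (.ofValue v)) with hr₁
    have hF (v : Value) (hv : HasType v τ₁) :
        IsGreatest (rewards (sem T ((e₂.close (Function.update σ x none)).subst x v)) r)
          (r₁ v) := by
      have := ih₂ hT (hσ.addVar x (MForm.hasShape_ofValue hv)) r
      rwa [MForm.eval_ofValue, ← Expr.subst_close] at this
    have hS := ih₁ hT hσ
    rw [Expr.close, sem, opt_letIn w₁ hd r r₁]
    · exact isGreatest_rewards_bindSet (hS r₁)
        fun d₁ hd₁ v hv => hF v (hasType_of_isGreatest w₁ hS hd₁ hv)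
    · intro ω₁ hω₁
      have := ih₂ hT ((hσ.of_agreeOff hω₁).addVar x w₁.shape) r
      rw [← Expr.subst_close] at this
      -- Both numbers are the maximum of the same set of rewards, since the closed body depends only
      -- on the bound value. Uniqueness of maxima therefore replaces a syntactic proof that the
      -- flips of `t₁` do not matter.
      exact this.unique (hF _ (w₁.shape.hasType_eval ω₁))
  | @call Γ g a τ₁ τ₂ χ c ρ ha hg hc hρ =>
    obtain ⟨w, F, hF, hr⟩ := hT g τ₁ τ₂ c hg hc
    rw [Expr.close, ha.close_eq hσ, sem_call hF, opt_call w (ha.flipsIn ∅) hρ]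
    have := hr (renameAssign ρ (substAssign ω c.arg χ)) r
    -- The parameter is read through component variables, which the renaming of flips leaves alone.
    rwa [eval_formF_congr (ω := substAssign ω c.arg χ) (ω' := renameAssign ρ (substAssign ω c.arg χ))
       (fun _ => rfl),
      eval_formF_substAssign ha.hasShape] at this

/-- Function definitions only extend the tables, so it suffices that each new entry is correct: its
body is closed by the single substitution of the argument. -/
theorem isGreatest_rewards_semProg {Γ : TyEnv} {Φ : CompTable} {T : FunTable} {p : Program}
    {τ : Ty} {φ : MForm} {γ : BForm} {t : Trace} (h : CompProg Γ Φ p τ φ γ t)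
    (hΓ : ∀ x, Γ.var x = none) (hT : TableCorrect Γ Φ T) :
    WellFormed τ φ γ t ∧
    ∀ ω r, IsGreatest (rewards (semProg T p) r) (opt t (guardedReward φ γ r) ω) := by
  induction h generalizing T with
  | main h =>
    refine ⟨wellFormed_of_comp h hT, fun ω r => ?_⟩
    have := isGreatest_rewards_sem h hT (σ := fun _ => none) (ω := ω)
      (fun x τ hx => by simp [hΓ] at hx) r
    rwa [Expr.close_none] at this
  | @func Γ Φ fd p τ φ φ' γ γ' t t' hf hp ih =>
    refine ih hΓ ?_
    intro g τ₁ τ₂ c hg hc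
    by_cases e : g = fd.name
    · subst e
      simp only [TyEnv.addFn, Function.update_self, Option.some.injEq, Prod.mk.injEq] at hg hc
      obtain ⟨rfl, rfl⟩ := hg
      subst hc
      refine ⟨wellFormed_of_comp hf hT, _, Function.update_self _ _ _, fun ω r => ?_⟩
      simp only [Expr.subst_eq_close]
      refine isGreatest_rewards_sem hf hT (fun y τ hy => ?_) r
      by_cases e : y = fd.arg
      · subst e
        simp only [TyEnv.addVar, Function.update_self, Option.some.injEq] at hy
        subst hy
        rw [Function.update_self]
      · simp [TyEnv.addVar, Function.update_of_ne e, hΓ] at hy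
    · simp only [TyEnv.addFn, Function.update_of_ne e] at hg hc
      obtain ⟨w, F, hF, hr⟩ := hT g τ₁ τ₂ c hg hc
      exact ⟨w, F, by rwa [Function.update_of_ne e], hr⟩

theorem Compiles.isGreatest_rewards {p : Program} {τ : Ty} {φ : MForm} {γ : BForm} {t : Trace}
    (h : Compiles p τ φ γ t) :
    WellFormed τ φ γ t ∧ ∀ ω r, IsGreatest (rewards (semProg (fun _ => none) p) r)
      (opt t (guardedReward φ γ r) ω) :=
  isGreatest_rewards_semProg h (fun _ => rfl) fun g τ₁ τ₂ c hg => by simp [TyEnv.empty] at hg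

/-! ### Existence of reduced diagrams -/

section Existence

variable {k : ℕ} {S : Type}

/-- The function `h` with its `i`-th argument fixed to `b`. -/
def cofactor (h : (Fin k → Bool) → S) (i : Fin k) (b : Bool) : (Fin k → Bool) → S :=
  fun a => h (Function.update a i b)

/-- The function `h` depends on its `i`-th argument. -/
def Essential (h : (Fin k → Bool) → S) (i : Fin k) : Prop :=
  cofactor h i true ≠ cofactor h i false

theorem cofactor_apply_self (h : (Fin k → Bool) → S) (i : Fin k) (a : Fin k → Bool) :
    cofactor h i (a i) a = h a := by
  rw [cofactor, Function.update_eq_self]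

theorem cofactor_of_not_essential {h : (Fin k → Bool) → S} {i : Fin k} (hi : ¬ Essential h i)
    (b : Bool) : cofactor h i b = h := by
  have hi : cofactor h i true = cofactor h i false := not_not.1 hi
  funext a
  rw [← cofactor_apply_self h i a]
  cases b <;> cases a i <;> simp only [hi]

/-- Two inputs are connected by changing one argument at a time, and no single change affects the
output. -/
theorem eq_of_not_essential {h : (Fin k → Bool) → S} (hh : ¬ ∃ i, Essential h i)
    (a a' : Fin k → Bool) : h a = h a' := by
  have key (s : Finset (Fin k)) : h (s.piecewise a a') = h a' := by
    induction s using Finset.induction_on with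
    | empty => rw [Finset.piecewise_empty]
    | insert i s _ ih =>
      rw [Finset.piecewise_insert, ← ih]
      exact congrFun (cofactor_of_not_essential (fun hi => hh ⟨i, hi⟩) (a i)) _
  simpa using key Finset.univ

theorem not_essential_cofactor_self (h : (Fin k → Bool) → S) (i : Fin k) (b : Bool) :
    ¬ Essential (cofactor h i b) i :=
  not_not.2 (by funext a; simp [cofactor])

theorem Essential.of_cofactor {h : (Fin k → Bool) → S} {i j : Fin k} {b : Bool}
    (hj : Essential (cofactor h i b) j) : Essential h j := by
  intro e
  by_cases hij : j = i
  · subst hij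
    exact not_essential_cofactor_self h j b hj
  · refine hj (funext fun a => ?_)
    have := congrFun e (Function.update a i b)
    simp only [cofactor] at this ⊢
    rwa [Function.update_comm hij, Function.update_comm hij]

/-- The first argument on which `h` depends. -/
noncomputable def testVar (h : (Fin k → Bool) → S) (hh : ∃ i, Essential h i) : Fin k :=
  wellFounded_lt.min {i | Essential h i} hh

theorem essential_testVar {h : (Fin k → Bool) → S} (hh : ∃ i, Essential h i) :
    Essential h (testVar h hh) :=
  wellFounded_lt.min_mem _ hh

/-- Fixing an argument creates no new dependencies, so `j` is at least the first essential argument;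
equality is excluded since that argument has been fixed. -/
theorem testVar_lt_of_essential {h : (Fin k → Bool) → S} (hh : ∃ i, Essential h i) {j : Fin k}
    {b : Bool} (hj : Essential (cofactor h (testVar h hh) b) j) : testVar h hh < j := by
  refine lt_of_le_of_ne (not_lt.1 (wellFounded_lt.not_lt_min _ hj.of_cofactor)) fun e => ?_
  rw [← e] at hj
  exact not_essential_cofactor_self _ _ _ hj

/-- The functions obtained from `f` by repeatedly fixing the first argument that matters. -/
inductive Subfunction (f : (Fin k → Bool) → S) : ((Fin k → Bool) → S) → Prop where
  | refl : Subfunction f f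
  | step {h : (Fin k → Bool) → S} (b : Bool) (hh : ∃ i, Essential h i) :
      Subfunction f h → Subfunction f (cofactor h (testVar h hh) b)

theorem Subfunction.exists_comp {f h : (Fin k → Bool) → S} (hf : Subfunction f h) :
    ∃ m : (Fin k → Bool) → (Fin k → Bool), f ∘ m = h := by
  induction hf with
  | refl => exact ⟨id, rfl⟩
  | step b hh _ ih =>
    obtain ⟨m, rfl⟩ := ih
    exact ⟨fun a => m (Function.update a _ b), rfl⟩

/-- The codomain may be infinite, but a subfunction is `f` precomposed with a self-map of the finite
cube, and there are finitely many of those. -/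
theorem finite_subfunction (f : (Fin k → Bool) → S) : {h | Subfunction f h}.Finite :=
  (Set.finite_range fun m : (Fin k → Bool) → (Fin k → Bool) => f ∘ m).subset
    fun _ hf => hf.exists_comp

/-- The inner nodes of the reduced diagram of `f`. -/
abbrev InnerNode (f : (Fin k → Bool) → S) : Type :=
  {h : (Fin k → Bool) → S // Subfunction f h ∧ ∃ i, Essential h i}

/-- The terminal nodes of the reduced diagram of `f`. -/
abbrev TerminalNode (f : (Fin k → Bool) → S) : Type :=
  {h : (Fin k → Bool) → S // Subfunction f h ∧ ¬ ∃ i, Essential h i}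

noncomputable instance (f : (Fin k → Bool) → S) : Fintype (InnerNode f) :=
  ((finite_subfunction f).subset fun _ h => h.1 :
    {h | Subfunction f h ∧ ∃ i, Essential h i}.Finite).fintype

noncomputable instance (f : (Fin k → Bool) → S) : Fintype (TerminalNode f) :=
  ((finite_subfunction f).subset fun _ h => h.1 :
    {h | Subfunction f h ∧ ¬ ∃ i, Essential h i}.Finite).fintype

open Classical in
/-- The node of a subfunction. -/
noncomputable def nodeOf {f : (Fin k → Bool) → S} (h : (Fin k → Bool) → S)
    (hf : Subfunction f h) : InnerNode f ⊕ TerminalNode f :=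
  if hh : ∃ i, Essential h i then .inl ⟨h, hf, hh⟩ else .inr ⟨h, hf, hh⟩

/-- The function of a node. -/
def nodeFun {f : (Fin k → Bool) → S} : InnerNode f ⊕ TerminalNode f → (Fin k → Bool) → S :=
  Sum.elim Subtype.val Subtype.val

theorem nodeFun_nodeOf {f h : (Fin k → Bool) → S} (hf : Subfunction f h) :
    nodeFun (nodeOf h hf) = h := by
  unfold nodeOf
  split_ifs <;> rfl

theorem subfunction_nodeFun {f : (Fin k → Bool) → S} (u : InnerNode f ⊕ TerminalNode f) :
    Subfunction f (nodeFun u) := by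
  rcases u with u | u <;> exact u.2.1

theorem nodeOf_nodeFun {f : (Fin k → Bool) → S} (u : InnerNode f ⊕ TerminalNode f) :
    nodeOf (nodeFun u) (subfunction_nodeFun u) = u := by
  unfold nodeOf
  rcases u with u | u
  · exact dif_pos u.2.2
  · exact dif_neg u.2.2

theorem nodeOf_injective {f h h' : (Fin k → Bool) → S} {hf : Subfunction f h}
    {hf' : Subfunction f h'} (e : nodeOf h hf = nodeOf h' hf') : h = h' := by
  rw [← nodeFun_nodeOf hf, e, nodeFun_nodeOf]

/-- The variable tested at an inner node. -/
noncomputable def InnerNode.var {f : (Fin k → Bool) → S} (u : InnerNode f) : Fin k :=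
  testVar u.1 u.2.2

/-- The successor of an inner node. -/
noncomputable def InnerNode.succ {f : (Fin k → Bool) → S} (u : InnerNode f) (b : Bool) :
    InnerNode f ⊕ TerminalNode f :=
  nodeOf _ (u.2.1.step b u.2.2)

theorem InnerNode.var_lt {f : (Fin k → Bool) → S} {u w : InnerNode f} {b : Bool}
    (h : u.succ b = .inl w) : u.var < w.var := by
  have e : cofactor u.1 u.var b = w.1 :=
    (nodeFun_nodeOf (u.2.1.step b u.2.2)).symm.trans (congrArg nodeFun h)
  refine testVar_lt_of_essential u.2.2 (b := b) ?_
  change Essential (cofactor u.1 u.var b) w.var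
  rw [e]
  exact essential_testVar w.2.2

/-- The edges of the reduced diagram. -/
def NodeEdge (f : (Fin k → Bool) → S) (x y : InnerNode f ⊕ TerminalNode f) : Prop :=
  ∃ w : InnerNode f, x = .inl w ∧ (y = w.succ true ∨ y = w.succ false)

/-- Edges strictly increase the tested variable; terminals get the rank `k`, above all variables. -/
theorem not_transGen_nodeEdge (f : (Fin k → Bool) → S) (u : InnerNode f ⊕ TerminalNode f) :
    ¬ Relation.TransGen (NodeEdge f) u u := by
  let rank : InnerNode f ⊕ TerminalNode f → ℕ := Sum.elim (fun w => w.var) fun _ => k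
  have edge (x y) (h : NodeEdge f x y) : rank x < rank y := by
    obtain ⟨w, rfl, h⟩ := h
    rcases y with y | y
    · rcases h with h | h <;> exact InnerNode.var_lt h.symm
    · exact w.var.2
  intro h
  have : ∀ v, Relation.TransGen (NodeEdge f) u v → rank u < rank v := fun v hv => by
    induction hv with
    | single h => exact edge _ _ h
    | tail _ h ih => exact ih.trans (edge _ _ h)
  exact (this u h).false

theorem reflTransGen_nodeEdge {f h : (Fin k → Bool) → S} (hf : Subfunction f h) :
    Relation.ReflTransGen (NodeEdge f) (nodeOf f .refl) (nodeOf h hf) := by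
  induction hf with
  | refl => exact .refl
  | @step h b hh hf ih =>
    refine ih.tail ⟨⟨h, hf, hh⟩, dif_pos hh, ?_⟩
    cases b
    · exact .inr rfl
    · exact .inl rfl

/-- The reduced diagram of a function: its nodes are the different subfunctions. -/
noncomputable def reducedADD (f : (Fin k → Bool) → S) : ADD k S where
  V := InnerNode f
  T := TerminalNode f
  root := nodeOf f .refl
  var := InnerNode.var
  thenN u := u.succ true
  elseN u := u.succ false
  val u := u.1 fun _ => false
  acyclic := not_transGen_nodeEdge f
  rooted u := by
    have := reflTransGen_nodeEdge (subfunction_nodeFun u)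
    rwa [nodeOf_nodeFun] at this

theorem reducedADD_ordered (f : (Fin k → Bool) → S) : (reducedADD f).Ordered := by
  rintro u w (h | h) <;> exact InnerNode.var_lt h

/-- Shannon expansion, by induction on a bound `n` for the number of variables from the tested one
onwards. -/
theorem reducedADD_represents (f : (Fin k → Bool) → S) : (reducedADD f).Represents f := by
  intro a
  have key : ∀ n : ℕ, ∀ u : InnerNode f ⊕ TerminalNode f,
      (∀ w, u = .inl w → k - w.var ≤ n) → (reducedADD f).Evals a u (nodeFun u a) := by
    intro n
    induction n with
    | zero =>
      rintro (u | u) hu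
      · have := hu u rfl
        have := u.var.2
        omega
      · have := ADD.Evals.terminal (A := reducedADD f) (b := a) u
        rwa [show (reducedADD f).val u = nodeFun (.inr u) a from eq_of_not_essential u.2.2 _ _]
          at this
    | succ n ih =>
      rintro (u | u) hu
      · have hs (b : Bool) (hb : a u.var = b) :
            (reducedADD f).Evals a (u.succ b) (nodeFun (.inl u) a) := by
          have := ih (u.succ b) fun w hw => by
            have h₁ := hu u rfl
            have h₂ := Fin.lt_def.1 (InnerNode.var_lt hw)
            omega
          rw [InnerNode.succ, nodeFun_nodeOf, ← hb] at this
          rw [InnerNode.succ]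
          subst hb
          convert this using 1
          exact (cofactor_apply_self u.1 u.var a).symm
        cases hb : a u.var with
        | true => exact .thenN (A := reducedADD f) u hb (hs true hb)
        | false => exact .elseN (A := reducedADD f) u hb (hs false hb)
      · exact ih _ fun w hw => by cases hw
  have := key k (nodeOf f .refl) fun w _ => Nat.sub_le _ _
  rwa [nodeFun_nodeOf] at this

/-- Nodes are functions, so equal functions are equal nodes. A function is recovered from its two
cofactors, or from a single value when it depends on nothing, which excludes all three kinds of
redundancy. -/
theorem reducedADD_reduced (f : (Fin k → Bool) → S) : (reducedADD f).Reduced where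
  no_redundant u h := essential_testVar u.2.2 (nodeOf_injective
    (hf := u.2.1.step true u.2.2) (hf' := u.2.1.step false u.2.2) h)
  no_dup_test u w huw := by
    by_contra! h
    obtain ⟨hv, ht, he⟩ := h
    refine huw (Subtype.ext (funext fun a => ?_))
    have hv : u.var = w.var := hv
    have hb (b : Bool) : cofactor u.1 u.var b = cofactor w.1 w.var b := by
      cases b
      · exact nodeOf_injective (hf := u.2.1.step false u.2.2) (hf' := w.2.1.step false w.2.2) he
      · exact nodeOf_injective (hf := u.2.1.step true u.2.2) (hf' := w.2.1.step true w.2.2) ht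
    rw [← cofactor_apply_self u.1 u.var a, hb, hv, cofactor_apply_self]
  no_dup_out u w huw h := huw <| Subtype.ext <| funext fun a => by
    rw [eq_of_not_essential u.2.2 a fun _ => false, eq_of_not_essential w.2.2 a fun _ => false]
    exact h

end Existence

theorem exists_isReducedADDFor (φ : MForm) (γ : BForm) (t : Trace) :
    ∃ A : ADD t.length Outcome, IsReducedADDFor φ γ t A :=
  ⟨reducedADD _, ⟨reducedADD_ordered _, reducedADD_represents _⟩, reducedADD_reduced _⟩

/-! ### Recursion on ordered diagrams -/

section Ordered

variable {k : ℕ} {S : Type}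

/-- The number of variables that may still be tested at a node. -/
def ADD.height (A : ADD k S) : A.V ⊕ A.T → ℕ :=
  Sum.elim (fun u => k - A.var u) fun _ => 0

theorem ADD.Ordered.height_lt {A : ADD k S} (hA : A.Ordered) {u : A.V} {s : A.V ⊕ A.T}
    (h : A.thenN u = s ∨ A.elseN u = s) : A.height s < A.height (.inl u) := by
  have := (A.var u).2
  rcases s with w | w
  · have := Fin.lt_def.1 (hA u w h)
    simp only [height, Sum.elim_inl]
    omega
  · simp only [height, Sum.elim_inl, Sum.elim_inr]
    omega

/-- The value of a node, computed from values `r` of the terminal nodes by combining the values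
of the successors of an inner node `u` with `c u`. -/
noncomputable def nodeValue (A : ADD k S) (hA : A.Ordered) (c : A.V → ℝ → ℝ → ℝ) (r : S → ℝ) :
    A.V ⊕ A.T → ℝ
  | .inr u => r (A.val u)
  | .inl u => c u (nodeValue A hA c r (A.thenN u)) (nodeValue A hA c r (A.elseN u))
termination_by s => A.height s
decreasing_by
  · exact hA.height_lt (.inl rfl)
  · exact hA.height_lt (.inr rfl)

theorem nodeValue_inr (A : ADD k S) (hA : A.Ordered) (c : A.V → ℝ → ℝ → ℝ) (r : S → ℝ)
    (u : A.T) : nodeValue A hA c r (.inr u) = r (A.val u) := by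
  rw [nodeValue]

theorem nodeValue_inl (A : ADD k S) (hA : A.Ordered) (c : A.V → ℝ → ℝ → ℝ) (r : S → ℝ)
    (u : A.V) : nodeValue A hA c r (.inl u) =
      c u (nodeValue A hA c r (A.thenN u)) (nodeValue A hA c r (A.elseN u)) := by
  rw [nodeValue]

theorem ADD.Ordered.induction {A : ADD k S} (hA : A.Ordered) {P : A.V ⊕ A.T → Prop}
    (hr : ∀ u, P (.inr u)) (hl : ∀ u, P (A.thenN u) → P (A.elseN u) → P (.inl u)) (s : A.V ⊕ A.T) :
    P s := by
  induction h : A.height s using Nat.strong_induction_on generalizing s with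
  | _ n ih =>
    subst h
    rcases s with u | u
    · exact hl u (ih _ (hA.height_lt (.inl rfl)) _ rfl) (ih _ (hA.height_lt (.inr rfl)) _ rfl)
    · exact hr u

theorem ADD.Evals.unique {A : ADD k S} {b : Fin k → Bool} {s : A.V ⊕ A.T} {o o' : S}
    (h : A.Evals b s o) (h' : A.Evals b s o') : o = o' := by
  induction h with
  | terminal u => cases h'; rfl
  | thenN u hu _ ih =>
    cases h' with
    | thenN _ _ h' => exact ih h'
    | elseN _ hu' _ => simp [hu] at hu'
  | elseN u hu _ ih =>
    cases h' with
    | thenN _ hu' _ => simp [hu] at hu'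
    | elseN _ _ h' => exact ih h'

/-- The weighted mean of `x` and `y`. -/
def mix (w x y : ℝ) : ℝ := w * x + (1 - w) * y

/-- With the branching weights fixed, expected rewards are linear. The optimal value is not, which
is why the weights are kept explicit. -/
theorem nodeValue_mix_add_mul (A : ADD k S) (hA : A.Ordered) (w : A.V → ℝ) (r r' : S → ℝ) (c : ℝ)
    (s : A.V ⊕ A.T) : nodeValue A hA (fun u => mix (w u)) (fun o => r o + c * r' o) s =
      nodeValue A hA (fun u => mix (w u)) r s + c * nodeValue A hA (fun u => mix (w u)) r' s := by
  induction s using hA.induction with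
  | hr u => simp only [nodeValue_inr]
  | hl u h₁ h₂ =>
    simp only [nodeValue_inl, h₁, h₂, mix]
    ring

theorem nodeValue_mix_mono (A : ADD k S) (hA : A.Ordered) {w : A.V → ℝ}
    (hw : ∀ u, w u ∈ Set.Icc (0 : ℝ) 1) {r r' : S → ℝ} (h : ∀ o, r o ≤ r' o) (s : A.V ⊕ A.T) :
    nodeValue A hA (fun u => mix (w u)) r s ≤ nodeValue A hA (fun u => mix (w u)) r' s := by
  induction s using hA.induction with
  | hr u => simpa only [nodeValue_inr] using h _
  | hl u h₁ h₂ =>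
    simp only [nodeValue_inl, mix]
    exact add_le_add (mul_le_mul_of_nonneg_left h₁ (hw u).1)
      (mul_le_mul_of_nonneg_left h₂ (sub_nonneg.2 (hw u).2))

theorem nodeValue_mix_zero (A : ADD k S) (hA : A.Ordered) (w : A.V → ℝ) (s : A.V ⊕ A.T) :
    nodeValue A hA (fun u => mix (w u)) (fun _ => 0) s = 0 := by
  induction s using hA.induction with
  | hr u => simp only [nodeValue_inr]
  | hl u h₁ h₂ => simp only [nodeValue_inl, mix, h₁, h₂]; ring

end Ordered

/-! ### Optimal values of diagrams -/

/-- The best expected reward from a node. -/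
noncomputable def bestValue (t : Trace) (A : ADD t.length Outcome) (hA : A.Ordered)
    (r : Outcome → ℝ) : A.V ⊕ A.T → ℝ :=
  nodeValue A hA (fun u => (t.get (A.var u)).2.combine) r

/-- The probability `w` of the then-branch is possible for a flip of kind `a`. -/
def FlipKind.Allows : FlipKind → ℝ → Prop
  | .prob θ, w => w = ((θ : ℚ) : ℝ)
  | .nondet, w => w ∈ Set.Icc (0 : ℝ) 1

theorem FlipKind.Allows.mem_Icc {a : FlipKind} {w : ℝ} (h : a.Allows w) :
    w ∈ Set.Icc (0 : ℝ) 1 := by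
  cases a with
  | prob θ =>
    simp only [Allows] at h
    subst h
    exact ⟨by exact_mod_cast θ.2.1, by exact_mod_cast θ.2.2⟩
  | nondet => exact h

theorem FlipKind.Allows.mix_le {a : FlipKind} {w x x' y y' : ℝ} (h : a.Allows w) (hx : x ≤ x')
    (hy : y ≤ y') : mix w x y ≤ a.combine x' y' := by
  have hw := h.mem_Icc
  have h₁ := mul_le_mul_of_nonneg_left hx hw.1
  have h₂ := mul_le_mul_of_nonneg_left hy (sub_nonneg.2 hw.2)
  cases a with
  | prob θ =>
    simp only [Allows] at h
    subst h
    exact add_le_add h₁ h₂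
  | nondet =>
    have h₃ := mul_le_mul_of_nonneg_left (le_max_left x' y') hw.1
    have h₄ := mul_le_mul_of_nonneg_left (le_max_right x' y') (sub_nonneg.2 hw.2)
    simp only [mix, combine]
    linarith

theorem nodeValue_mix_le_bestValue (t : Trace) (A : ADD t.length Outcome) (hA : A.Ordered)
    (r : Outcome → ℝ) {w : A.V → ℝ} (hw : ∀ u, (t.get (A.var u)).2.Allows (w u))
    (s : A.V ⊕ A.T) : nodeValue A hA (fun u => mix (w u)) r s ≤ bestValue t A hA r s := by
  unfold bestValue
  induction s using hA.induction with
  | hr u => simp only [nodeValue_inr, le_refl]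
  | hl u h₁ h₂ =>
    rw [nodeValue_inl, nodeValue_inl]
    exact (hw u).mix_le h₁ h₂

/-- The probabilities of the then-branches under deterministic choices. -/
def detWeight (t : Trace) (A : ADD t.length Outcome) (c : A.V → Bool) (u : A.V) : ℝ :=
  match (t.get (A.var u)).2 with
  | .prob θ => ((θ : ℚ) : ℝ)
  | .nondet => if c u then 1 else 0

/-- The greedy choice of the better successor is optimal from every node at once, so a maximum over
finitely many weightings suffices. -/
theorem exists_nodeValue_detWeight_eq (t : Trace) (A : ADD t.length Outcome) (hA : A.Ordered)
    (r : Outcome → ℝ) : ∃ c : A.V → Bool, ∀ s,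
      nodeValue A hA (fun u => mix (detWeight t A c u)) r s = bestValue t A hA r s := by
  classical
  refine ⟨fun u => decide (bestValue t A hA r (A.elseN u) ≤ bestValue t A hA r (A.thenN u)),
    fun s => ?_⟩
  induction s using hA.induction with
  | hr u => simp only [bestValue, nodeValue_inr]
  | hl u h₁ h₂ =>
    rw [nodeValue_inl, h₁, h₂, bestValue, nodeValue_inl, ← bestValue]
    unfold detWeight
    cases (t.get (A.var u)).2 with
    | prob θ => rfl
    | nondet =>
      simp only [decide_eq_true_eq, FlipKind.combine, mix]
      split_ifs with h
      · rw [max_eq_left h]; ring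
      · rw [max_eq_right (not_le.1 h).le]; ring

/-- Both sides are backward inductions, but the trace performs every flip while the diagram may skip
some. The induction runs over the remaining flips `n` with `s` testing none of the first `j`
variables; the last hypothesis says that the rewards of reachable assignments are those of the
terminals reached from `s`. -/
theorem opt_drop_eq_bestValue (t : Trace) (ht : t.flips.Nodup) (A : ADD t.length Outcome)
    (hA : A.Ordered) (r : Outcome → ℝ) (g : (FVar → Bool) → ℝ) (n : ℕ) :
    ∀ (j : ℕ), j + n = t.length → ∀ (s : A.V ⊕ A.T) (ω : FVar → Bool),
      (∀ u, s = .inl u → j ≤ A.var u) →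
      (∀ ω', AgreeOff {f | f ∈ Trace.flips (t.drop j)} ω ω' →
        ∀ o, A.Evals (fun i => ω' (.flip (t.get i).1)) s o → g ω' = r o) →
      opt (t.drop j) g ω = bestValue t A hA r s := by
  induction n with
  | zero =>
    intro j hj s ω hs hg
    rcases s with u | u
    · have := hs u rfl
      have := (A.var u).2
      omega
    · rw [List.drop_eq_nil_of_le (by omega), bestValue, nodeValue_inr]
      exact hg ω (AgreeOff.refl _ _) _ (.terminal u)
  | succ n ih =>
    intro j hj s ω hs hg
    have hjl : j < t.length := by omega
    have hdrop : t.drop j = t[j] :: t.drop (j + 1) := List.drop_eq_getElem_cons hjl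
    have hnd : t[j].1 ∉ Trace.flips (t.drop (j + 1)) := by
      have h : (Trace.flips (t.drop j)).Nodup := by
        rw [Trace.flips, List.map_drop]
        exact ht.sublist (List.drop_sublist _ _)
      rw [hdrop] at h
      exact (List.nodup_cons.1 h).1
    -- As the flips are distinct, the later ones cannot overwrite the outcome `b` of the current
    -- one.
    have hagree (b : Bool) (ω' : FVar → Bool)
        (h : AgreeOff {f | f ∈ Trace.flips (t.drop (j + 1))} (setFlip ω t[j].1 b) ω') :
        AgreeOff {f | f ∈ Trace.flips (t.drop j)} ω ω' ∧ ω' (.flip t[j].1) = b := by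
      refine ⟨⟨h.1, fun f hf => ?_⟩, ?_⟩
      · rw [hdrop] at hf
        have hf' : ¬ (f = t[j].1 ∨ f ∈ Trace.flips (t.drop (j + 1))) :=
          fun h => hf (List.mem_cons.2 h)
        rw [h.2 f fun hf'' => hf' (.inr hf'')]
        exact if_neg fun e => hf' (.inl e)
      · rw [h.2 _ hnd]
        exact if_pos rfl
    by_cases hu : ∃ u, s = .inl u ∧ (A.var u : ℕ) = j
    · obtain ⟨u, rfl, hu⟩ := hu
      have hget : t.get (A.var u) = t[j] := by simp [List.get_eq_getElem, hu]
      rw [hdrop, opt, bestValue, nodeValue_inl, hget, ← bestValue]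
      congr 1
      · refine ih (j + 1) (by omega) _ _ (fun w hw => ?_) fun ω' hω' o ho => ?_
        · have := Fin.lt_def.1 (hA u w (.inl hw))
          omega
        · obtain ⟨h₁, h₂⟩ := hagree _ ω' hω'
          exact hg ω' h₁ o (.thenN u (by rw [hget]; exact h₂) ho)
      · refine ih (j + 1) (by omega) _ _ (fun w hw => ?_) fun ω' hω' o ho => ?_
        · have := Fin.lt_def.1 (hA u w (.inr hw))
          omega
        · obtain ⟨h₁, h₂⟩ := hagree _ ω' hω'
          exact hg ω' h₁ o (.elseN u (by rw [hget]; exact h₂) ho)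
    -- The diagram skips variable `j`: both outcomes lead to the same value, and combining a value
    -- with itself changes nothing.
    · have key (b : Bool) : opt (t.drop (j + 1)) g (setFlip ω t[j].1 b) =
          bestValue t A hA r s := by
        refine ih (j + 1) (by omega) s _ (fun u hs' => ?_) fun ω' hω' => hg ω' (hagree b ω' hω').1
        have h₁ := hs u hs'
        have h₂ : (A.var u : ℕ) ≠ j := fun e => hu ⟨u, hs', e⟩
        omega
      rw [hdrop, opt, key, key, FlipKind.combine_self]

/-- The reward of an outcome; rejected runs are not rewarded. -/
def outcomeReward (r : Value → ℝ) : Outcome → ℝ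
  | .val v => r v
  | .rejected => 0

theorem assignment_flip {t : Trace} {f : ℕ} (hf : f ∈ t.flips) (ω : FVar → Bool) :
    assignment t (fun i => ω (.flip (t.get i).1)) (.flip f) = ω (.flip f) := by
  obtain ⟨q, hq, rfl⟩ := List.mem_map.1 hf
  obtain ⟨i, rfl⟩ := List.mem_iff_get.1 hq
  rw [assignment, Bool.eq_iff_iff, decide_eq_true_eq]
  exact ⟨fun ⟨j, hj, h⟩ => hj ▸ h, fun h => ⟨i, rfl, h⟩⟩

theorem opt_eq_bestValue {t : Trace} {τ : Ty} {φ : MForm} {γ : BForm} (w : WellFormed τ φ γ t)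
    {A : ADD t.length Outcome} (hA : IsADDFor φ γ t A) (r : Value → ℝ) :
    opt t (guardedReward φ γ r) (fun _ => false) =
      bestValue t A hA.1 (outcomeReward r) A.root := by
  refine opt_drop_eq_bestValue t w.nodup A hA.1 (outcomeReward r) (guardedReward φ γ r) t.length 0
    (by omega) _ _ (fun _ _ => Nat.zero_le _) fun ω' hω' o ho => ?_
  have hc : ∀ x p, assignment t (fun i => ω' (.flip (t.get i).1)) (.comp x p) =
      ω' (.comp x p) := fun x p => (hω'.1 x p).symm
  have hf : ∀ f ∈ {f | f ∈ t.flips}, assignment t (fun i => ω' (.flip (t.get i).1)) (.flip f) =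
      ω' (.flip f) := fun f hf => assignment_flip hf ω'
  rw [ho.unique (hA.2 _), guarded, BForm.eval_congr hc hf w.acc, MForm.eval_congr hc hf w.flips,
    guardedReward]
  split_ifs <;> rfl

/-! ### Reachability probabilities -/

/-- The finite paths from `s` that end in their first visit to `F`. -/
def MDP.reachFrom (M : MDP) (F : Set M.S) (s : M.S) : Set (List M.S) :=
  {π | π.head? = some s ∧ ∃ l s', π = l ++ [s'] ∧ (∀ x ∈ l, x ∉ F) ∧ s' ∈ F}

/-- The probability of a step from `s` to `s'`. -/
def MDP.stepProb (M : MDP) (Θ : M.Scheduler) (s s' : M.S) : ℝ := ∑ α, Θ.choice s α * M.P s α s'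

theorem MDP.stepProb_nonneg (M : MDP) (Θ : M.Scheduler) (s s' : M.S) : 0 ≤ M.stepProb Θ s s' :=
  Finset.sum_nonneg fun α _ => mul_nonneg (Θ.nonneg s α) (M.nonneg s α s')

/-- Visiting `F` already counts as visiting `G`, so both goals are first met at the first visit to
`F`. -/
theorem MDP.reachBoth_eq_reach (M : MDP) {F G : Set M.S} (h : F ⊆ G) :
    M.reachBoth F G = M.reach F := by
  ext π
  refine and_congr_right fun _ => exists_congr fun l => exists_congr fun s =>
    and_congr_right fun e => ⟨?_, ?_⟩
  · rintro ⟨h₁, ⟨x, hx, hxF⟩, -⟩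
    have h₂ : ∀ y ∈ l, y ∉ F := fun y hy hyF => h₁ ⟨⟨y, hy, hyF⟩, y, hy, h hyF⟩
    refine ⟨h₂, ?_⟩
    rw [e, List.mem_append, List.mem_singleton] at hx
    rcases hx with hx | rfl
    · exact (h₂ x hx hxF).elim
    · exact hxF
  · rintro ⟨h₁, h₂⟩
    have hs : s ∈ π := by rw [e]; simp
    exact ⟨fun ⟨⟨y, hy, hyF⟩, _⟩ => h₁ y hy hyF, ⟨s, hs, h₂⟩, s, hs, h h₂⟩

theorem MDP.reachFrom_of_mem (M : MDP) {F : Set M.S} {s : M.S} (hs : s ∈ F) :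
    M.reachFrom F s = {[s]} := by
  ext π
  constructor
  · rintro ⟨h₁, l, s', rfl, h₂, -⟩
    cases l with
    | nil =>
      simp only [List.nil_append, List.head?_cons, Option.some.injEq] at h₁
      subst h₁
      rfl
    | cons x l =>
      simp only [List.cons_append, List.head?_cons, Option.some.injEq] at h₁
      subst h₁
      exact (h₂ x List.mem_cons_self hs).elim
  · rintro rfl
    exact ⟨rfl, [], s, rfl, fun _ h => by simp at h, hs⟩

theorem MDP.reachFrom_of_notMem (M : MDP) {F : Set M.S} {s : M.S} (hs : s ∉ F) :
    M.reachFrom F s = List.cons s '' ⋃ s', M.reachFrom F s' := by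
  ext π
  constructor
  · rintro ⟨h₁, l, s', rfl, h₂, h₃⟩
    cases l with
    | nil =>
      simp only [List.nil_append, List.head?_cons, Option.some.injEq] at h₁
      subst h₁
      exact (hs h₃).elim
    | cons x l =>
      simp only [List.cons_append, List.head?_cons, Option.some.injEq] at h₁
      subst h₁
      have hne : l ++ [s'] ≠ [] := by simp
      refine ⟨l ++ [s'], Set.mem_iUnion.2 ⟨(l ++ [s']).head hne, List.head?_eq_some_head hne,
        l, s', rfl, fun y hy => h₂ y (List.mem_cons_of_mem _ hy), h₃⟩, rfl⟩
  · rintro ⟨π, hπ, rfl⟩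
    obtain ⟨_, _, l, s', rfl, h₂, h₃⟩ := Set.mem_iUnion.1 hπ
    refine ⟨rfl, s :: l, s', rfl, fun y hy => ?_, h₃⟩
    rcases List.mem_cons.1 hy with rfl | hy
    · exact hs
    · exact h₂ y hy

theorem MDP.pathProb_cons (M : MDP) (Θ : M.Scheduler) (s : M.S) {s' : M.S} {π : List M.S}
    (h : π.head? = some s') :
    M.pathProb Θ (s :: π) = M.stepProb Θ s s' * M.pathProb Θ π := by
  cases π with
  | nil => simp at h
  | cons x π =>
    simp only [List.head?_cons, Option.some.injEq] at h
    subst h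
    rfl

theorem MDP.Pr_reachFrom_of_mem (M : MDP) (Θ : M.Scheduler) {F : Set M.S} {s : M.S}
    (hs : s ∈ F) : M.Pr Θ (M.reachFrom F s) = 1 := by
  rw [M.reachFrom_of_mem hs, Pr, tsum_singleton [s] fun π => ENNReal.ofReal (M.pathProb Θ π)]
  simp [pathProb]

/-- The one-step equation: remove the first state and sort the remaining paths by their head, which
makes the classes disjoint. -/
theorem MDP.Pr_reachFrom_of_notMem (M : MDP) (Θ : M.Scheduler) {F : Set M.S} {s : M.S}
    (hs : s ∉ F) : M.Pr Θ (M.reachFrom F s) =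
      ∑ s', ENNReal.ofReal (M.stepProb Θ s s') * M.Pr Θ (M.reachFrom F s') := by
  have hd : Set.univ.PairwiseDisjoint (M.reachFrom F) := fun x _ y _ hxy =>
    Set.disjoint_left.2 fun π h₁ h₂ => hxy (Option.some.inj (h₁.1.symm.trans h₂.1))
  rw [M.reachFrom_of_notMem hs, Pr,
    tsum_image (fun π => ENNReal.ofReal (M.pathProb Θ π)) List.cons_injective.injOn,
    ENNReal.tsum_biUnion (f := fun π => ENNReal.ofReal (M.pathProb Θ (s :: π))) hd, tsum_fintype]
  refine Finset.sum_congr rfl fun s' _ => ?_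
  rw [Pr, ← ENNReal.tsum_mul_left]
  refine tsum_congr fun π => ?_
  rw [M.pathProb_cons Θ s π.2.1, ENNReal.ofReal_mul (M.stepProb_nonneg Θ s s')]

/-- At a self-loop the one-step equation is vacuous, so paths are treated directly: a path that ends
in `F` must leave `s`, and that step has probability 0. -/
theorem MDP.Pr_reachFrom_of_absorbing (M : MDP) (Θ : M.Scheduler) {F : Set M.S} {s : M.S}
    (hs : s ∉ F) (h : ∀ s', s' ≠ s → M.stepProb Θ s s' = 0) : M.Pr Θ (M.reachFrom F s) = 0 := by
  refine ENNReal.tsum_eq_zero.2 fun ⟨π, hπ⟩ => ?_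
  suffices M.pathProb Θ π = 0 by simp only [this, ENNReal.ofReal_zero]
  induction π with
  | nil => simp [reachFrom] at hπ
  | cons x π ih =>
    rw [M.reachFrom_of_notMem hs] at hπ
    obtain ⟨π', hπ', e⟩ := hπ
    obtain ⟨rfl, rfl⟩ := List.cons_eq_cons.1 e
    obtain ⟨s', hs'⟩ := Set.mem_iUnion.1 hπ'
    rw [M.pathProb_cons Θ s hs'.1]
    by_cases hss : s' = s
    · subst hss
      rw [ih hs', mul_zero]
    · rw [h s' hss, zero_mul]

/-! ### The lifted process -/

theorem LAct.sum_eq (f : LAct → ℝ) : ∑ α, f α = f .l + f .r + f .d := by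
  have : (Finset.univ : Finset LAct) = {.l, .r, .d} := rfl
  rw [this, Finset.sum_insert (by decide), Finset.sum_pair (by decide), add_assoc]

section Lift

variable {t : Trace} {A : ADD t.length Outcome}

theorem choice_eq_zero {Θ : (lift t A).Scheduler} {s : A.V ⊕ A.T} {α : LAct}
    (h : ∀ s', liftP t A s α s' = 0) : Θ.choice s α = 0 := by
  by_contra hc
  obtain ⟨s', hs'⟩ := Θ.enabled s α hc
  exact hs'.ne' (h s')

theorem choice_sum (Θ : (lift t A).Scheduler) (s : A.V ⊕ A.T) :
    Θ.choice s LAct.l + Θ.choice s LAct.r + Θ.choice s LAct.d = 1 := by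
  rw [← Θ.sum_one s]
  exact (LAct.sum_eq _).symm

theorem stepProb_lift (Θ : (lift t A).Scheduler) (s s' : A.V ⊕ A.T) :
    (lift t A).stepProb Θ s s' = Θ.choice s LAct.l * liftP t A s .l s' +
      Θ.choice s LAct.r * liftP t A s .r s' + Θ.choice s LAct.d * liftP t A s .d s' :=
  LAct.sum_eq _

theorem stepProb_inr (Θ : (lift t A).Scheduler) (u : A.T) (s' : A.V ⊕ A.T) :
    (lift t A).stepProb Θ (.inr u) s' = pt (.inr u) s' := by
  have hl : Θ.choice (Sum.inr u) LAct.l = 0 := choice_eq_zero fun _ => rfl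
  have hr : Θ.choice (Sum.inr u) LAct.r = 0 := choice_eq_zero fun _ => rfl
  have h := choice_sum Θ (.inr u)
  have hd : Θ.choice (Sum.inr u) LAct.d = 1 := by linarith
  rw [stepProb_lift, hl, hr, hd]
  simp [liftP]

/-- The probability of the then-branch of an inner node. -/
def thenProb (Θ : (lift t A).Scheduler) (u : A.V) : ℝ :=
  match (t.get (A.var u)).2 with
  | .prob θ => ((θ : ℚ) : ℝ)
  | .nondet => Θ.choice (Sum.inl u) LAct.l

theorem allows_thenProb (Θ : (lift t A).Scheduler) (u : A.V) :
    (t.get (A.var u)).2.Allows (thenProb Θ u) := by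
  unfold thenProb
  cases (t.get (A.var u)).2 with
  | prob θ => rfl
  | nondet =>
    have h := choice_sum Θ (.inl u)
    have hr := Θ.nonneg (Sum.inl u) LAct.r
    have hd := Θ.nonneg (Sum.inl u) LAct.d
    exact ⟨Θ.nonneg _ _, by linarith⟩

theorem stepProb_inl (Θ : (lift t A).Scheduler) (u : A.V) (s' : A.V ⊕ A.T) :
    (lift t A).stepProb Θ (.inl u) s' =
      mix (thenProb Θ u) (pt (A.thenN u) s') (pt (A.elseN u) s') := by
  have h := choice_sum Θ (.inl u)
  rw [stepProb_lift]
  cases ha : (t.get (A.var u)).2 with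
  | prob θ =>
    have hl : Θ.choice (Sum.inl u) LAct.l = 0 := choice_eq_zero fun _ => by simp [liftP, ha, -List.get_eq_getElem]
    have hr : Θ.choice (Sum.inl u) LAct.r = 0 := choice_eq_zero fun _ => by simp [liftP, ha, -List.get_eq_getElem]
    have hd : Θ.choice (Sum.inl u) LAct.d = 1 := by linarith
    rw [hl, hr, hd]
    simp [liftP, thenProb, ha, mix, -List.get_eq_getElem]
  | nondet =>
    have hd : Θ.choice (Sum.inl u) LAct.d = 0 := choice_eq_zero fun _ => by simp [liftP, ha, -List.get_eq_getElem]
    have hr : Θ.choice (Sum.inl u) LAct.r = 1 - Θ.choice (Sum.inl u) LAct.l := by linarith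
    rw [hd, hr]
    simp [liftP, thenProb, ha, mix, -List.get_eq_getElem]

/-- At inner nodes the one-step equation is the recursion of `nodeValue`; goal terminals count 1,
and other terminals are absorbing and count 0. -/
theorem Pr_reachFrom_lift (hA : A.Ordered) (Θ : (lift t A).Scheduler) (F : Set (lift t A).S)
    (r : Outcome → ℝ) (hl : ∀ u : A.V, (Sum.inl u : A.V ⊕ A.T) ∉ F)
    (h₁ : ∀ u : A.T, (Sum.inr u : A.V ⊕ A.T) ∈ F → r (A.val u) = 1)
    (h₀ : ∀ u : A.T, (Sum.inr u : A.V ⊕ A.T) ∉ F → r (A.val u) = 0) (hr : ∀ o, 0 ≤ r o)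
    (s : A.V ⊕ A.T) :
    (lift t A).Pr Θ ((lift t A).reachFrom F s) =
      ENNReal.ofReal (nodeValue A hA (fun u => mix (thenProb Θ u)) r s) := by
  classical
  induction s using hA.induction with
  | hr u =>
    rw [nodeValue_inr]
    by_cases hu : (Sum.inr u : A.V ⊕ A.T) ∈ F
    · rw [MDP.Pr_reachFrom_of_mem _ _ hu, h₁ u hu, ENNReal.ofReal_one]
    · rw [h₀ u hu, ENNReal.ofReal_zero]
      refine MDP.Pr_reachFrom_of_absorbing _ _ hu fun s' hs' => ?_
      exact (stepProb_inr Θ u s').trans (if_neg hs')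
  | hl u ih₁ ih₂ =>
    have hw := (allows_thenProb Θ u).mem_Icc
    have hw' := sub_nonneg.2 hw.2
    have hn (s : A.V ⊕ A.T) : 0 ≤ nodeValue A hA (fun u => mix (thenProb Θ u)) r s := by
      have := nodeValue_mix_mono A hA (fun u => (allows_thenProb Θ u).mem_Icc) hr s
      rwa [nodeValue_mix_zero] at this
    have hpt (x y : A.V ⊕ A.T) : ENNReal.ofReal (pt x y) = if y = x then 1 else 0 := by
      unfold pt
      split_ifs <;> simp
    have hstep (s' : A.V ⊕ A.T) : ENNReal.ofReal ((lift t A).stepProb Θ (.inl u) s') =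
        ENNReal.ofReal (thenProb Θ u) * (if s' = A.thenN u then 1 else 0) +
        ENNReal.ofReal (1 - thenProb Θ u) * (if s' = A.elseN u then 1 else 0) := by
      rw [stepProb_inl, mix, ENNReal.ofReal_add (mul_nonneg hw.1 (pt_nonneg _ _))
        (mul_nonneg hw' (pt_nonneg _ _)), ENNReal.ofReal_mul hw.1, ENNReal.ofReal_mul hw', hpt,
        hpt]
    rw [MDP.Pr_reachFrom_of_notMem _ _ (hl u), nodeValue_inl, mix,
      ENNReal.ofReal_add (mul_nonneg hw.1 (hn _)) (mul_nonneg hw' (hn _)),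
      ENNReal.ofReal_mul hw.1, ENNReal.ofReal_mul hw', ← ih₁, ← ih₂]
    refine (Finset.sum_congr rfl fun s' _ => by rw [hstep s']).trans ?_
    simp only [add_mul, mul_assoc, ite_mul, one_mul, zero_mul, Finset.sum_add_distrib, mul_ite,
      mul_zero]
    exact congrArg₂ _ (Fintype.sum_ite_eq' _ _) (Fintype.sum_ite_eq' _ _)

/-! ### Conditional reachability as a ratio of expected rewards -/

/-- The reward of the outcome `v`. -/
noncomputable def valueReward (v : Value) : Outcome → ℝ :=
  outcomeReward fun w => if w = v then 1 else 0

/-- The reward of accepted outcomes. -/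
noncomputable def acceptReward : Outcome → ℝ := outcomeReward fun _ => 1

theorem valueReward_nonneg (v : Value) (o : Outcome) : 0 ≤ valueReward v o := by
  cases o <;> simp only [valueReward, outcomeReward, le_refl]
  split_ifs <;> norm_num

theorem valueReward_le (v : Value) (o : Outcome) : valueReward v o ≤ acceptReward o := by
  cases o <;> simp only [valueReward, acceptReward, outcomeReward, le_refl]
  split_ifs <;> norm_num

/-- A state labeled `v` is also labeled accepted, so the conjunction in the numerator reduces to
reaching `v`. The conventions for division by zero agree, since the numerator is bounded by the
denominator. -/
theorem condReach_lift (hA : A.Ordered) (Θ : (lift t A).Scheduler) (v : Value) :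
    (lift t A).condReach Θ ((lift t A).states (.val v)) ((lift t A).states .accepted) =
      nodeValue A hA (fun u => mix (thenProb Θ u)) (valueReward v) A.root /
        nodeValue A hA (fun u => mix (thenProb Θ u)) acceptReward A.root := by
  have hval (u : A.T) : (Sum.inr u : A.V ⊕ A.T) ∈ (lift t A).states (.val v) ↔
      A.val u = .val v := by
    change LProp.val v ∈ liftL t A (.inr u) ↔ _
    simp only [liftL]
    cases A.val u <;> simp [eq_comm]
  have hacc (u : A.T) : (Sum.inr u : A.V ⊕ A.T) ∈ (lift t A).states .accepted ↔
      A.val u ≠ .rejected := by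
    change LProp.accepted ∈ liftL t A (.inr u) ↔ _
    simp only [liftL]
    cases A.val u <;> simp
  have hsub : (lift t A).states (.val v) ⊆ (lift t A).states .accepted := by
    rintro (u | u) hu
    · exact hu.elim
    · exact (hacc u).2 (by rw [(hval u).1 hu]; simp)
  have hmono := fun u => (allows_thenProb Θ u).mem_Icc
  have hv := nodeValue_mix_mono A hA hmono (valueReward_nonneg v) A.root
  have ha := hv.trans (nodeValue_mix_mono A hA hmono (valueReward_le v) A.root)
  rw [nodeValue_mix_zero] at hv ha
  have e₁ : (lift t A).Pr Θ ((lift t A).reach ((lift t A).states (.val v))) = _ :=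
    Pr_reachFrom_lift hA Θ ((lift t A).states (.val v)) (valueReward v) (fun u hu => hu.elim)
      (fun u hu => by rw [(hval u).1 hu]; simp [valueReward, outcomeReward])
      (fun u hu => by
        rw [hval] at hu
        cases h : A.val u with
        | val w => exact if_neg fun e => hu (by rw [h, e])
        | rejected => rfl) (valueReward_nonneg v) A.root
  have e₂ : (lift t A).Pr Θ ((lift t A).reach ((lift t A).states .accepted)) = _ :=
    Pr_reachFrom_lift hA Θ ((lift t A).states .accepted) acceptReward (fun u hu => hu.elim)
      (fun u hu => by
        rw [hacc] at hu
        cases h : A.val u with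
        | val w => rfl
        | rejected => exact (hu h).elim)
      (fun u hu => by
        rw [hacc, not_not] at hu
        rw [hu]
        rfl) (fun o => (valueReward_nonneg v o).trans (valueReward_le v o)) A.root
  rw [MDP.condReach, MDP.reachBoth_eq_reach _ hsub, e₁, e₂, ENNReal.toReal_div,
    ENNReal.toReal_ofReal hv, ENNReal.toReal_ofReal ha]

theorem enabled_of_sum_eq_one {s : A.V ⊕ A.T} {α : LAct} (h : ∑ s', liftP t A s α s' = 1) :
    (lift t A).Enabled s α := by
  by_contra hn
  have : ∀ s', liftP t A s α s' = 0 := fun s' =>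
    le_antisymm (not_lt.1 fun h' => hn ⟨s', h'⟩) (liftP_nonneg t A s α s')
  simp [this] at h

/-- The distribution over actions of a deterministic scheduler. -/
def detChoice (t : Trace) (A : ADD t.length Outcome) (c : A.V → Bool) : A.V ⊕ A.T → LAct → ℝ
  | .inr _, .d => 1
  | .inr _, _ => 0
  | .inl u, α =>
      match (t.get (A.var u)).2, α with
      | .prob _, .d => 1
      | .nondet, .l => if c u then 1 else 0
      | .nondet, .r => if c u then 0 else 1
      | _, _ => 0

theorem exists_thenProb_eq_detWeight (t : Trace) (A : ADD t.length Outcome) (c : A.V → Bool) :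
    ∃ Θ : (lift t A).Scheduler, thenProb Θ = detWeight t A c := by
  refine ⟨⟨detChoice t A c, ?_, ?_, ?_⟩, ?_⟩
  · rintro (u | u) α
    · simp only [detChoice]
      cases (t.get (A.var u)).2 <;> cases α <;> simp only [le_refl, zero_le_one] <;>
        split_ifs <;> norm_num
    · cases α <;> simp [detChoice]
  · intro s
    refine (LAct.sum_eq _).trans ?_
    rcases s with u | u
    · simp only [detChoice]
      cases (t.get (A.var u)).2
      · norm_num
      · cases c u <;> norm_num
    · simp [detChoice]
  · rintro (u | u) α hα
    · refine enabled_of_sum_eq_one ((liftP_sum t A (.inl u) α).resolve_left fun h₀ => ?_)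
      simp only [detChoice] at hα
      cases h : (t.get (A.var u)).2 <;> cases α <;>
        simp [liftP, h, Finset.sum_add_distrib, ← Finset.mul_sum, sum_pt, -List.get_eq_getElem,
          -Fintype.sum_sum_type] at h₀ hα
    · refine enabled_of_sum_eq_one ((liftP_sum t A (.inr u) α).resolve_left fun h₀ => ?_)
      cases α <;> simp [liftP, detChoice, sum_pt] at h₀ hα
  · funext u
    unfold thenProb detWeight
    cases h : (t.get (A.var u)).2 with
    | prob θ => rfl
    | nondet => simp [detChoice, h, -List.get_eq_getElem]

end Lift

/-! ### Maximal ratios -/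

/-- If all the maxima of `N + β D` over `X` and over `Y` agree, and those over `Y` are attained in
a finite set, then the maxima of `N / D` are attained and agree. -/
theorem exists_isGreatest_ratio {X Y Z : Set (ℝ × ℝ)} (hZ : Z.Finite) (hZY : Z ⊆ Y)
    (hX : ∀ x ∈ X, 0 ≤ x.1 ∧ x.1 ≤ x.2) (hY : ∀ x ∈ Y, 0 ≤ x.1 ∧ x.1 ≤ x.2)
    (hmax : ∀ β : ℝ, ∃ z ∈ Z, (∃ x ∈ X, x.1 + β * x.2 = z.1 + β * z.2) ∧
      (∀ x ∈ X, x.1 + β * x.2 ≤ z.1 + β * z.2) ∧ ∀ y ∈ Y, y.1 + β * y.2 ≤ z.1 + β * z.2) :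
    ∃ m, IsGreatest ((fun x : ℝ × ℝ => x.1 / x.2) '' X) m ∧
      IsGreatest ((fun x : ℝ × ℝ => x.1 / x.2) '' Y) m := by
  have hne : Z.Nonempty := let ⟨z, hz, _⟩ := hmax 0; ⟨z, hz⟩
  obtain ⟨z₀, hz₀, hz₀max⟩ := Set.exists_max_image Z (fun x => x.1 / x.2) hZ hne
  set m := z₀.1 / z₀.2 with hm
  have hm₀ : 0 ≤ m := div_nonneg (hY _ (hZY hz₀)).1 ((hY _ (hZY hz₀)).1.trans (hY _ (hZY hz₀)).2)
  -- Clearing the denominator is valid even when it vanishes: then the numerator is 0, the quotient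
  -- is 0 by convention, and `m` is nonnegative.
  have lin (x : ℝ × ℝ) (hx : 0 ≤ x.1 ∧ x.1 ≤ x.2) : x.1 / x.2 ≤ m ↔ x.1 + -m * x.2 ≤ 0 := by
    rcases (hx.1.trans hx.2).eq_or_lt with h | h
    · have : x.1 = 0 := le_antisymm (h ▸ hx.2) hx.1
      simp [← h, this, hm₀]
    · rw [div_le_iff₀ h]
      constructor <;> intro <;> linarith
  have hZm : ∀ z ∈ Z, z.1 + -m * z.2 ≤ 0 := fun z hz => (lin z (hY z (hZY hz))).1 (hz₀max z hz)
  obtain ⟨z₁, hz₁, ⟨x₁, hx₁, -⟩, hXm, hYm⟩ := hmax (-m)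
  have hXm : ∀ x ∈ X, x.1 + -m * x.2 ≤ 0 := fun x hx => (hXm x hx).trans (hZm z₁ hz₁)
  have hYm : ∀ y ∈ Y, y.1 + -m * y.2 ≤ 0 := fun y hy => (hYm y hy).trans (hZm z₁ hz₁)
  refine ⟨m, ⟨?_, ?_⟩, ⟨z₀, hZY hz₀, rfl⟩, ?_⟩
  -- If `m = 0`, any point of `X` attains it. If `m > 0`, a point with `N = mD` and `D > 0` is
  -- required, and a maximizer for `β = -m` could be `(0, 0)`.
  · rcases hm₀.eq_or_lt with h₀ | hpos
    · refine ⟨x₁, hx₁, le_antisymm ((lin x₁ (hX x₁ hx₁)).2 (hXm x₁ hx₁)) ?_⟩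
      rw [← h₀]
      exact div_nonneg (hX x₁ hx₁).1 ((hX x₁ hx₁).1.trans (hX x₁ hx₁).2)
    · have hD₀ : 0 < z₀.2 := by
        refine lt_of_le_of_ne ((hY _ (hZY hz₀)).1.trans (hY _ (hZY hz₀)).2) fun h => ?_
        rw [hm, ← h, div_zero] at hpos
        exact hpos.false
      have hline : z₀.1 + -m * z₀.2 = 0 := by
        rw [hm]
        field_simp
        ring
      -- Among the points of `Z` on the line `N = mD`, the one with the largest denominator; a
      -- slight increase of β above `-m` favours it.
      obtain ⟨z₂, ⟨hz₂, hz₂l⟩, hz₂max⟩ := Set.exists_max_image {z ∈ Z | z.1 + -m * z.2 = 0}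
        (fun z => z.2) (hZ.subset fun _ h => h.1) ⟨z₀, hz₀, hline⟩
      have hD₂ : 0 < z₂.2 := hD₀.trans_le (hz₂max z₀ ⟨hz₀, hline⟩)
      -- Points of `Z` off the line have `N - mD < 0`, and there are finitely many, so for small ε
      -- none of them beats `z₂`.
      have hev : ∀ᶠ ε in nhdsWithin (0 : ℝ) (Set.Ioi 0),
          ∀ z ∈ Z, z.1 + -m * z.2 + ε * z.2 ≤ ε * z₂.2 := by
        refine (Filter.eventually_all_finite hZ).2 fun z hz => ?_
        rcases (hZm z hz).eq_or_lt with h | h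
        · filter_upwards [self_mem_nhdsWithin] with ε hε
          rw [h, zero_add]
          exact mul_le_mul_of_nonneg_left (hz₂max z ⟨hz, h⟩) (le_of_lt hε)
        · have hc : Continuous fun ε : ℝ => z.1 + -m * z.2 + ε * z.2 - ε * z₂.2 := by fun_prop
          have := (hc.tendsto 0).eventually_lt_const (u := 0) (by simpa using h)
          filter_upwards [nhdsWithin_le_nhds this] with ε hε
          linarith
      obtain ⟨ε, hε, hε₀⟩ := (hev.and self_mem_nhdsWithin).exists
      have hε₀ : 0 < ε := hε₀
      -- Two perturbations are compared. Optimality of `x` at `ε / 2` gives `N - mD + (ε/2) D ≥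
      -- (ε/2) D₂`, and with `N - mD ≤ 0` this yields `D ≥ D₂`. The upper bound `N - mD + ε D ≤ ε
      -- D₂` at `ε` yields `D ≤ D₂`. Hence `D = D₂ > 0`, and then `N = mD`.
      obtain ⟨z, hz, ⟨x, hx, hxz⟩, -, hzY⟩ := hmax (-m + ε / 2)
      obtain ⟨z', hz', -, hzX, -⟩ := hmax (-m + ε)
      have k₁ := hzY z₂ (hZY hz₂)
      have k₂ := (hzX x hx).trans_eq (by ring : z'.1 + (-m + ε) * z'.2 = z'.1 + -m * z'.2 + ε * z'.2)
      have k₃ := k₂.trans (hε z' hz')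
      have k₄ := hXm x hx
      have hx₂ : x.2 = z₂.2 := by
        refine le_antisymm ?_ ?_
        · refine le_of_mul_le_mul_left (a := ε / 2) ?_ (by linarith)
          nlinarith
        · refine le_of_mul_le_mul_left (a := ε / 2) ?_ (by linarith)
          nlinarith
      refine ⟨x, hx, ?_⟩
      have hxp : 0 < x.2 := hx₂ ▸ hD₂
      have k₅ : x.1 + -m * x.2 = 0 := by
        rw [← hx₂] at k₁ hz₂l
        nlinarith
      rw [div_eq_iff hxp.ne']
      linarith
  · rintro _ ⟨x, hx, rfl⟩
    exact (lin x (hX x hx)).2 (hXm x hx)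
  · rintro _ ⟨y, hy, rfl⟩
    exact (lin y (hY y hy)).2 (hYm y hy)

/-- The normalization of a sub-distribution. -/
noncomputable def SubDist.normalized (d : SubDist) : SubDist :=
  .ofFinset d.mass.support (fun v => d v / d.total)
    (fun v => div_nonneg (d.nonneg v) (Finset.sum_nonneg fun w _ => d.nonneg w))
    (fun v hv => by rw [Finsupp.notMem_support_iff.1 hv, zero_div])
    (by rw [← Finset.sum_div]; exact div_self_le_one _)

/-- Normalizing a sub-distribution gives a sub-distribution again, also when the total mass is 0, so
every quotient does occur in the normalized semantics. -/
theorem normalize_eval (S : Set SubDist) (v : Value) :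
    {x : ℝ | ∃ d ∈ normalize S, x = d v} =
      (fun x : ℝ × ℝ => x.1 / x.2) '' ((fun d : SubDist => (d v, d.total)) '' S) := by
  ext x
  constructor
  · rintro ⟨d', ⟨d, hd, h⟩, rfl⟩
    exact ⟨_, ⟨d, hd, rfl⟩, (h v).symm⟩
  · rintro ⟨_, ⟨d, hd, rfl⟩, rfl⟩
    exact ⟨d.normalized, ⟨d, hd, fun _ => rfl⟩, rfl⟩

/-- The ratio lemma is applied to the pairs (mass of `v`, accepted mass) of the semantics, of all
schedulers, and of the deterministic schedulers. -/
theorem exists_isMaxCondReach {p : Program} {τ : Ty} {φ : MForm} {γ : BForm} {t : Trace}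
    (hp : Compiles p τ φ γ t) {A : ADD t.length Outcome} (hA : IsADDFor φ γ t A) (v : Value) :
    ∃ m : ℝ, (lift t A).IsMaxCondReach ((lift t A).states (.val v))
        ((lift t A).states .accepted) m ∧
      IsGreatest {x : ℝ | ∃ d ∈ normSem p, x = d v} m := by
  obtain ⟨w, hsem⟩ := hp.isGreatest_rewards
  set S := semProg (fun _ => none) p with hS
  let pair (q : A.V → ℝ) : ℝ × ℝ :=
    (nodeValue A hA.1 (fun u => mix (q u)) (valueReward v) A.root,
      nodeValue A hA.1 (fun u => mix (q u)) acceptReward A.root)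
  have hratio := exists_isGreatest_ratio
    (X := (fun d : SubDist => (d v, d.total)) '' S)
    (Y := Set.range fun Θ : (lift t A).Scheduler => pair (thenProb Θ))
    (Z := Set.range fun c : A.V → Bool => pair (detWeight t A c)) (Set.finite_range _)
  refine (hratio ?_ ?_ ?_ ?_).imp fun m ⟨hmX, hmY⟩ => ?_
  · rintro _ ⟨c, rfl⟩
    obtain ⟨Θ, hΘ⟩ := exists_thenProb_eq_detWeight t A c
    exact ⟨Θ, by simp only [hΘ]⟩
  · rintro _ ⟨d, _, rfl⟩
    refine ⟨d.nonneg v, ?_⟩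
    simp only [← d.expect_one]
    rw [← d.expect_single v]
    exact d.expect_mono fun w _ => by split_ifs <;> norm_num
  · rintro _ ⟨Θ, rfl⟩
    have hmono := fun u => (allows_thenProb Θ u).mem_Icc
    have := nodeValue_mix_mono A hA.1 hmono (valueReward_nonneg v) A.root
    rw [nodeValue_mix_zero] at this
    exact ⟨this, nodeValue_mix_mono A hA.1 hmono (valueReward_le v) A.root⟩
  · intro β
    -- The expected value of this reward is N + βD, for sub-distributions and schedulers alike.
    set r : Value → ℝ := fun w => (if w = v then 1 else 0) + β * 1 with hr
    have hr' : outcomeReward r = fun o => valueReward v o + β * acceptReward o := by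
      funext o
      cases o <;> simp [hr, outcomeReward, valueReward, acceptReward]
    have hd (d : SubDist) : d.expect r = d v + β * d.total := by
      rw [hr, d.expect_add_mul, d.expect_single, d.expect_one]
    have hq (q : A.V → ℝ) : nodeValue A hA.1 (fun u => mix (q u)) (outcomeReward r) A.root =
        (pair q).1 + β * (pair q).2 := by
      rw [hr', nodeValue_mix_add_mul]
    obtain ⟨c, hc⟩ := exists_nodeValue_detWeight_eq t A hA.1 (outcomeReward r)
    have hc := hc A.root
    have hs := hsem (fun _ => false) r
    -- The semantic maximum is now expressed by the greedy deterministic scheduler, which serves as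
    -- the common witness `z` for this β.
    rw [opt_eq_bestValue w hA, ← hc, hq] at hs
    rw [hq] at hc
    refine ⟨_, ⟨c, rfl⟩, ?_, ?_, ?_⟩
    · obtain ⟨d, hdS, e⟩ := hs.1
      exact ⟨_, ⟨d, hdS, rfl⟩, by rw [e, hd]⟩
    · rintro _ ⟨d, hdS, rfl⟩
      have := hs.2 ⟨d, hdS, rfl⟩
      rwa [hd] at this
    · rintro _ ⟨Θ, rfl⟩
      have := nodeValue_mix_le_bestValue t A hA.1 (outcomeReward r) (allows_thenProb Θ) A.root
      rwa [hq, ← hc] at this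
  · constructor
    · rw [← Set.range_comp] at hmY
      unfold MDP.IsMaxCondReach
      convert hmY using 1
      ext x
      simp only [Set.mem_ofPred_eq, Set.mem_range, Function.comp_apply, pair,
        condReach_lift hA.1, eq_comm]
    · rw [normSem, normalize_eval]
      exact hmX

end NoDice

theorem theorem1 (p : NoDice.Program) (τ : NoDice.Ty) (φ : NoDice.MForm) (γ : NoDice.BForm)
    (t : NoDice.Trace) (hp : NoDice.Compiles p τ φ γ t) :
    (∃ A : NoDice.ADD t.length NoDice.Outcome, NoDice.IsReducedADDFor φ γ t A) ∧
    ∀ A : NoDice.ADD t.length NoDice.Outcome, NoDice.IsReducedADDFor φ γ t A →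
      ∀ v : NoDice.Value, ∃ m : ℝ,
        (NoDice.lift t A).IsMaxCondReach
          ((NoDice.lift t A).states (NoDice.LProp.val v))
          ((NoDice.lift t A).states NoDice.LProp.accepted) m ∧
        IsGreatest {x : ℝ | ∃ d ∈ NoDice.normSem p, x = d v} m := by
  exact ⟨NoDice.exists_isReducedADDFor φ γ t, fun _ hA => NoDice.exists_isMaxCondReach hp hA.1⟩
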